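/- **Setting.** Let $T\in\mathbb N$, let $\xi_t:\Omega\to\Xi_t\subseteq\mathbb R^{d_t}$ $(t=1,\dots,T)$ be random vectors on a probability space, $\xi_{[t]}=(\xi_1,\dots,\xi_t)$, $\mathcal F_t=\sigma(\xi_{[t]})$, and let $\kappa_t(\cdot\mid\xi_{[t-1]})$ be a regular conditional distribution of $\xi_t$ given $\xi_{[t-1]}$; $\mathbb E_{|\mathcal F_{t-1}}$ is evaluated with these kernels. Let $h_t:\mathbb R^{n_t}\times\mathbb R^{d_t}\to\mathbb R$ be continuous. Let $\mathscr X_t(x_{[t-1]},\xi_{[t-1]})\subseteq\mathbb R^{n_t}$ be compact sets, nonempty whenever $(x_{[t-1]},\xi_{[t-1]})$ is feasible (i.e. $x_s\in\mathscr X_s(x_{[s-1]},\xi_{[s-1]})$ for all $s<t$), upper hemicontinuous in $x_{[t-1]}$, and such that $\xi_{[t-1]}\mapsto\{(x_{[t-1]},x_t):x_t\in\mathscr X_t(x_{[t-1]},\xi_{[t-1]})\}$ is a measurable multifunction (preimages of closed sets are measurable). For every $\xi_{[t-1]}$ let $\mathcal U_t(\xi_{[t-1]})$ be a set of bounded, upper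 semicontinuous, nondecreasing functions $u:\mathbb R\to\mathbb R$ that is compact for $L^p$ convergence on bounded intervals ($0<p\le\infty$ fixed) and depends measurably on $\xi_{[t-1]}$ (it has a Castaing representation: a sequence of jointly measurable selections that are dense in $\mathcal U_t(\xi_{[t-1]})$ for every $\xi_{[t-1]}$). Assume $|u|\le b_t(\xi_{[t-1]})$ for all $u\in\mathcal U_t(\xi_{[t-1]})$, where $b_t$ is measurable and $b_t(\xi_{[t-1]})$ is integrable under its conditional law given $\xi_{[s-1]}$, for all $s\le t$ and all values of $\xi_{[s-1]}$. Let $\mathcal U$ be the set of all sequences $\vec{\mathfrak u}=(\mathfrak u_1,\dots,\mathfrak u_T)$ of jointly measurable functions $\mathfrak u_t(y,\xi_{[t-1]})$ with $\mathfrak u_t(\cdot,\xi_{[t-1]})\in\mathcal U_t(\xi_{[t-1]})$ for all $\xi_{[t-1]}$. An implementable policy is $x=(x_1,\dots,x_T)$ with $x_t$ a Borel measurable function of $\xi_{[t-1]}$; it is feasible if $x_t\in\mathscr X_t(x_{[t-1]},\xi_{[t-1]})$ almost surely for all $t$. The problem (MS-PRO-SD) is $$\max_{x\text{ feasible}}\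 \inf_{\vec{\mathfrak u}\in\mathcal U}\ \mathbb E\Big[\sum_{t=1}^T\mathfrak u_t(h_t(x_t,\xi_t),\xi_{[t-1]})\Big].$$ For a history $(x_{[t-1]},\xi_{[t-1]})$, its sub-problem from stage $t$ is $$\max_{x_t,\dots,x_T}\ \inf_{\vec{\mathfrak u}\in\mathcal U}\ \mathbb E_{|\mathcal F_{t-1}}\Big[\sum_{s=t}^T\mathfrak u_s(h_s(x_s,\xi_s),\xi_{[s-1]})\Big],$$ the constraints holding almost surely under the conditional law given $\xi_{[t-1]}$. Assume that $\mathcal U$ is rectangular: $\mathcal U\neq\emptyset$ and for every implementable policy $x$, with $Z_t=h_t(x_t,\xi_t)$, $$\inf_{\vec{\mathfrak u}\in\mathcal U}\mathbb E\Big[\sum_{t=1}^T\mathfrak u_t(Z_t,\xi_{[t-1]})\Big]=\inf_{u_1\in\mathcal U_1}\mathbb E\Big[u_1(Z_1)+\inf_{u_2\in\mathcal U_2(\xi_{[1]})}\mathbb E_{|\mathcal F_1}\big[u_2(Z_2)+\cdots+\inf_{u_T\in\mathcal U_T(\xi_{[T-1]})}\mathbb E_{|\mathcal F_{T-1}}[u_T(Z_T)]\cdots\big]\Big].$$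 **Theorem.** There are functions $V_1,\dots,V_{T+1}$ with $V_{T+1}=0$ such that, for $t=1,\dots,T$ and every feasible history $(x_{[t-1]},\xi_{[t-1]})$, $$V_t(x_{[t-1]},\xi_{[t-1]})=\max_{x_t\in\mathscr X_t(x_{[t-1]},\xi_{[t-1]})}\ \inf_{u_t\in\mathcal U_t(\xi_{[t-1]})}\ \mathbb E_{|\mathcal F_{t-1}}\big[u_t(h_t(x_t,\xi_t))+V_{t+1}(x_{[t]},\xi_{[t]})\big],$$ where the maximum is attained and the functions under the expectations are integrable. $V_t(x_{[t-1]},\xi_{[t-1]})$ is the (attained) optimal value of the sub-problem from stage $t$ at every feasible history; in particular $V_1$ is the (attained) optimal value of (MS-PRO-SD). Moreover (MS-PRO-SD) is time consistent: every optimal policy of (MS-PRO-SD) is, for every stage $t$ and almost every $\xi_{[t-1]}$, also optimal for the sub-problem from stage $t$ at the history it generates. -/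

import Mathlib

open MeasureTheory ProbabilityTheory Filter Topology
open scoped ENNReal

noncomputable section

namespace PRO

/-! ### Histories

Stages are numbered `0, 1, …, T - 1` (they correspond to `1, …, T` in the usual numbering), so that
a history available at the beginning of stage `t` consists of the entries of the stages
`0, …, t - 1`. -/

/-- `Hist A t` is the type of histories `a_[t] = (a_0, …, a_{t-1})` with `a_s : A s`. -/
def Hist (A : ℕ → Type) : ℕ → Type
  | 0 => Unit
  | t + 1 => Hist A t × A t

/-- Append one entry to a history. -/
def Hist.snoc {A : ℕ → Type} {t : ℕ} (a : Hist A t) (b : A t) : Hist A (t + 1) :=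
  ((a, b) : Hist A t × A t)

/-- Forget the last entry of a history. -/
def Hist.init {A : ℕ → Type} {t : ℕ} (a : Hist A (t + 1)) : Hist A t :=
  (show Hist A t × A t from a).1

/-- The last entry of a history. -/
def Hist.last {A : ℕ → Type} {t : ℕ} (a : Hist A (t + 1)) : A t :=
  (show Hist A t × A t from a).2

/-- Histories carry the product topology. -/
instance Hist.instTopologicalSpace (A : ℕ → Type) [∀ t, TopologicalSpace (A t)] :
    ∀ t, TopologicalSpace (Hist A t)
  | 0 => inferInstanceAs (TopologicalSpace Unit)
  | t + 1 =>
    letI := Hist.instTopologicalSpace A t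
    inferInstanceAs (TopologicalSpace (Hist A t × A t))

/-- Histories carry the product σ-algebra. -/
instance Hist.instMeasurableSpace (A : ℕ → Type) [∀ t, MeasurableSpace (A t)] :
    ∀ t, MeasurableSpace (Hist A t)
  | 0 => inferInstanceAs (MeasurableSpace Unit)
  | t + 1 =>
    letI := Hist.instMeasurableSpace A t
    inferInstanceAs (MeasurableSpace (Hist A t × A t))

theorem Hist.measurable_snoc {A : ℕ → Type} [∀ t, MeasurableSpace (A t)] {t : ℕ} :
    Measurable (fun p : Hist A t × A t => Hist.snoc p.1 p.2) :=
  measurable_id (α := Hist A t × A t)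

theorem Hist.continuous_snoc {A : ℕ → Type} [∀ t, TopologicalSpace (A t)] {t : ℕ} :
    Continuous (fun p : Hist A t × A t => Hist.snoc p.1 p.2) :=
  continuous_id (X := Hist A t × A t)

/-- The history `ω ↦ (ξ_0 ω, …, ξ_{t-1} ω)` of a process `ξ`. The σ-algebra it generates is the
information available at the beginning of stage `t`. -/
def histOf {Ω : Type*} {A : ℕ → Type} (ξ : ∀ t, Ω → A t) : ∀ t, Ω → Hist A t
  | 0, _ => ()
  | t + 1, ω => Hist.snoc (histOf ξ t ω) (ξ t ω)

/-! ### Utility functions -/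

/-- A bounded, upper semicontinuous (nondecreasing) utility function. -/
structure IsUtility (u : ℝ → ℝ) : Prop where
  monotone : Monotone u
  usc : UpperSemicontinuous u
  bounded : ∃ C : ℝ, ∀ y, |u y| ≤ C

/-- Convergence `v_j → u` in `L^p` on every bounded interval. -/
def UtilTendsto (p : ℝ≥0∞) (v : ℕ → ℝ → ℝ) (u : ℝ → ℝ) : Prop :=
  ∀ R : ℝ, Tendsto
    (fun j => eLpNorm (fun y => v j y - u y) p (volume.restrict (Set.Icc (-R) R))) atTop (𝓝 0)

/-- Compactness of a set of utility functions for `L^p` convergence on bounded intervals. As that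
topology is pseudometrizable, this is the same as sequential compactness. -/
def UtilCompact (p : ℝ≥0∞) (K : Set (ℝ → ℝ)) : Prop :=
  ∀ v : ℕ → ℝ → ℝ, (∀ j, v j ∈ K) →
    ∃ u ∈ K, ∃ φ : ℕ → ℕ, StrictMono φ ∧ UtilTendsto p (fun j => v (φ j)) u

/-- Measurability of the set-valued map `s ↦ K s` of utility functions: it has a Castaing
representation, i.e. a sequence of jointly measurable selections whose values at each `s` are
dense in `K s` for `L^p` convergence on bounded intervals. -/
def UtilMeasurable {S : Type*} [MeasurableSpace S] (p : ℝ≥0∞) (K : S → Set (ℝ → ℝ)) : Prop :=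
  ∃ v : ℕ → S → ℝ → ℝ,
    (∀ k, Measurable (fun q : S × ℝ => v k q.1 q.2)) ∧
    (∀ k s, v k s ∈ K s) ∧
    ∀ s, ∀ u ∈ K s, ∃ φ : ℕ → ℕ, UtilTendsto p (fun j => v (φ j) s) u

/-- Measurability of a family of set-valued maps `x ↦ G x s`, `s ∈ S`: the map that sends `s` to
the graph of `G · s` is a measurable multifunction, i.e. the preimages of closed sets are
measurable. -/
def GraphMeasurable {S E F : Type*} [MeasurableSpace S] [TopologicalSpace E] [TopologicalSpace F]
    (G : E → S → Set F) : Prop :=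
  ∀ C : Set (E × F), IsClosed C → MeasurableSet {s | ∃ q ∈ C, q.2 ∈ G q.1 s}

/-! ### The model -/

/-- The data of a multistage preference robust problem with state-dependent utilities: the horizon
`T`, the dimensions `n t` of the decision `x_t` and `d t` of the random vector `ξ_t`, the set
`Ξ t` in which `ξ_t` takes its values, the reward functions `h t`, the feasible sets
`X t x_[t-1] ξ_[t-1]` and the stage ambiguity sets `U t ξ_[t-1]`. -/
structure Model where
  T : ℕ
  n : ℕ → ℕ
  d : ℕ → ℕ
  Ξ : ∀ t, Set (EuclideanSpace ℝ (Fin (d t)))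
  h : ∀ t, EuclideanSpace ℝ (Fin (n t)) × EuclideanSpace ℝ (Fin (d t)) → ℝ
  X : ∀ t, Hist (fun s => EuclideanSpace ℝ (Fin (n s))) t → Hist (fun s => Ξ s) t →
    Set (EuclideanSpace ℝ (Fin (n t)))
  U : ∀ t, Hist (fun s => Ξ s) t → Set (ℝ → ℝ)

namespace Model

variable (M : Model)

/-- Decisions of stage `t`. -/
abbrev Dec (t : ℕ) : Type := EuclideanSpace ℝ (Fin (M.n t))

/-- Histories of decisions before stage `t`. -/
abbrev DecHist (t : ℕ) : Type := Hist (fun s => EuclideanSpace ℝ (Fin (M.n s))) t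

/-- Histories of observations before stage `t`. -/
abbrev ObsHist (t : ℕ) : Type := Hist (fun s => M.Ξ s) t

/-- Policies: the decision of stage `t` is a function of the observations before stage `t`. -/
abbrev Policy : Type := ∀ t, M.ObsHist t → M.Dec t

/-- State-dependent utility sequences `(u_t(·, ξ_[t-1]))_t`. -/
abbrev UtilSeq : Type := ∀ t, M.ObsHist t → ℝ → ℝ

/-- `π` is implementable: each of its decisions is a measurable function of the observed history. -/
def Implementable (π : M.Policy) : Prop := ∀ t < M.T, Measurable (π t)

/-- The ambiguity set of utility sequences: the (measurable) state-dependent utility sequences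
whose stage `t` member lies in the stage ambiguity set `U t ξ_[t-1]` for every history. -/
def ambiguitySet : Set M.UtilSeq :=
  {u | ∀ t < M.T, Measurable (fun q : M.ObsHist t × ℝ => u t q.1 q.2) ∧ ∀ ξ, u t ξ ∈ M.U t ξ}

/-- The pair of histories `(x_[t-1], ξ_[t-1])` is feasible: every past decision was feasible. -/
def FeasHist : ∀ t, M.DecHist t → M.ObsHist t → Prop
  | 0, _, _ => True
  | t + 1, x, ξ => FeasHist t x.init ξ.init ∧ x.last ∈ M.X t x.init ξ.init

/-- The decisions taken by the policy `π` along the observations, when the policy is applied from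
stage `t` on and the decisions before stage `t` were `x`. -/
def decisionsFrom (π : M.Policy) {t : ℕ} (x : M.DecHist t) :
    ∀ k, M.ObsHist (t + k) → M.DecHist (t + k)
  | 0, _ => x
  | k + 1, ξ => Hist.snoc (decisionsFrom π x k (Hist.init ξ)) (π (t + k) (Hist.init ξ))

/-- The decisions before stage `t` taken by the policy `π` along the observations. -/
def decisions (π : M.Policy) : ∀ t, M.ObsHist t → M.DecHist t
  | 0, _ => ()
  | t + 1, ξ => Hist.snoc (decisions π t ξ.init) (π t ξ.init)

/-! ### The problem (MS-PRO-SD) -/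

section Global

variable {Ω : Type*} [MeasurableSpace Ω] (P : Measure Ω) (ξ : ∀ t, Ω → M.Ξ t)

/-- Feasible policies: implementable, and almost surely satisfying the constraints. -/
def Feasible (π : M.Policy) : Prop :=
  M.Implementable π ∧ ∀ t < M.T, ∀ᵐ ω ∂P,
    π t (histOf ξ t ω) ∈ M.X t (M.decisions π t (histOf ξ t ω)) (histOf ξ t ω)

/-- The expected total utility of a policy under a utility sequence. -/
def expectedUtility (u : M.UtilSeq) (π : M.Policy) : ℝ :=
  ∫ ω, ∑ t ∈ Finset.range M.T,
    u t (histOf ξ t ω) (M.h t (π t (histOf ξ t ω), (ξ t ω : EuclideanSpace ℝ (Fin (M.d t))))) ∂P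

/-- The worst-case expected total utility of a policy: the objective of (MS-PRO-SD). -/
def robustValue (π : M.Policy) : ℝ :=
  ⨅ u : M.ambiguitySet, M.expectedUtility P ξ u.1 π

/-- `π` is an optimal policy of (MS-PRO-SD). -/
def IsOptimal (π : M.Policy) : Prop :=
  M.Feasible P ξ π ∧ ∀ π', M.Feasible P ξ π' → M.robustValue P ξ π' ≤ M.robustValue P ξ π

end Global

/-! ### Conditional problems, nested values and dynamic programming

`κ t` is a regular conditional distribution of `ξ_t` given the history `ξ_[t-1]`. -/

section Conditional

variable (κ : ∀ t, Kernel (M.ObsHist t) (M.Ξ t))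

/-- The conditional distribution of `(ξ_0, …, ξ_{t+k-1})` given that `(ξ_0, …, ξ_{t-1}) = ξ`. -/
def condLaw {t : ℕ} (ξ : M.ObsHist t) : ∀ k, Measure (M.ObsHist (t + k))
  | 0 => Measure.dirac ξ
  | k + 1 => (condLaw ξ k ⊗ₘ κ (t + k)).map (fun q => Hist.snoc q.1 q.2)

/-- The total utility of the stages `t, …, t + k - 1`. -/
def totalUtility (u : M.UtilSeq) (π : M.Policy) (t : ℕ) : ∀ k, M.ObsHist (t + k) → ℝ
  | 0, _ => 0
  | k + 1, ξ => totalUtility u π t k (Hist.init ξ) +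
      u (t + k) (Hist.init ξ) (M.h (t + k) (π (t + k) (Hist.init ξ),
        ((Hist.last ξ : M.Ξ (t + k)) : EuclideanSpace ℝ (Fin (M.d (t + k))))))

/-- Feasibility of a policy for the sub-problem that starts at stage `t` after the decisions `x`
and the observations `ξ`. -/
def SubFeasible {t : ℕ} (x : M.DecHist t) (ξ : M.ObsHist t) (π : M.Policy) : Prop :=
  M.Implementable π ∧ ∀ k, t + k < M.T → ∀ᵐ ζ ∂(M.condLaw κ ξ k),
    π (t + k) ζ ∈ M.X (t + k) (M.decisionsFrom π x k ζ) ζ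

/-- The worst-case conditional expected total utility of the stages `t, …, T - 1` given that the
observations before stage `t` are `ξ`. -/
def subRobustValue {t : ℕ} (ξ : M.ObsHist t) (π : M.Policy) : ℝ :=
  ⨅ u : M.ambiguitySet,
    ∫ ζ, M.totalUtility u.1 π t (M.T - t) ζ ∂(M.condLaw κ ξ (M.T - t))

/-- `π` is optimal for the sub-problem from stage `t` to the last stage, given the history. -/
def IsSubOptimal {t : ℕ} (x : M.DecHist t) (ξ : M.ObsHist t) (π : M.Policy) : Prop :=
  M.SubFeasible κ x ξ π ∧
    ∀ π', M.SubFeasible κ x ξ π' → M.subRobustValue κ ξ π' ≤ M.subRobustValue κ ξ π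

/-- The nested worst-case value
`inf_{u_t} E[u_t(h_t(x_t, ξ_t)) + inf_{u_{t+1}} E[u_{t+1}(h_{t+1}(x_{t+1}, ξ_{t+1})) + ⋯ | ξ_[t]]`
`| ξ_[t-1]]` of a policy over `k` stages, beginning with stage `t`. -/
def nestedValue (π : M.Policy) : ∀ (_k t : ℕ), M.ObsHist t → ℝ
  | 0, _, _ => 0
  | k + 1, t, ξ => ⨅ u : M.U t ξ,
      ∫ z, (u.1 (M.h t (π t ξ, (z : EuclideanSpace ℝ (Fin (M.d t))))) +
        nestedValue π k (t + 1) (Hist.snoc ξ z)) ∂(κ t ξ)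

/-- Rectangularity: the ambiguity set is nonempty and for every implementable policy the
worst-case expected total utility is equal to the nested worst-case value. -/
def IsRectangular {Ω : Type*} [MeasurableSpace Ω] (P : Measure Ω) (ξ : ∀ t, Ω → M.Ξ t) : Prop :=
  M.ambiguitySet.Nonempty ∧
    ∀ π, M.Implementable π → M.robustValue P ξ π = M.nestedValue κ π M.T 0 ()

/-- The one-stage objective of the dynamic programming recursion at stage `t`, for a given
cost-to-go function `W` of the next stage:
`inf_{u ∈ U_t(ξ_[t-1])} E[u(h_t(y, ξ_t)) + W((x_[t-1], y), ξ_[t]) | ξ_[t-1]]`. -/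
def stageObjective (t : ℕ) (W : M.DecHist (t + 1) → M.ObsHist (t + 1) → ℝ)
    (x : M.DecHist t) (ξ : M.ObsHist t) (y : M.Dec t) : ℝ :=
  ⨅ u : M.U t ξ, ∫ z, (u.1 (M.h t (y, (z : EuclideanSpace ℝ (Fin (M.d t))))) +
    W (Hist.snoc x y) (Hist.snoc ξ z)) ∂(κ t ξ)

/-- `V` satisfies the backward recursion: it vanishes after the last stage and, at every feasible
history of every stage, `V t x ξ` is the maximum (attained) of the one-stage objective with
cost-to-go `V (t + 1)` over the feasible decisions. The conditional expectations in the recursion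
are required to be those of integrable functions. -/
structure SatisfiesRecursion (V : ∀ t, M.DecHist t → M.ObsHist t → ℝ) : Prop where
  terminal : ∀ x ξ, V M.T x ξ = 0
  integrable : ∀ t < M.T, ∀ x ξ, M.FeasHist t x ξ → ∀ y ∈ M.X t x ξ, ∀ u ∈ M.U t ξ,
    Integrable (fun z : M.Ξ t => u (M.h t (y, (z : EuclideanSpace ℝ (Fin (M.d t))))) +
      V (t + 1) (Hist.snoc x y) (Hist.snoc ξ z)) (κ t ξ)
  step : ∀ t < M.T, ∀ x ξ, M.FeasHist t x ξ →
    IsGreatest (M.stageObjective κ t (V (t + 1)) x ξ '' M.X t x ξ) (V t x ξ)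

/-- Time consistency: every optimal policy of (MS-PRO-SD) is, at every stage `t` and along almost
every history, also optimal for the sub-problem from stage `t` to the last stage. -/
def TimeConsistent {Ω : Type*} [MeasurableSpace Ω] (P : Measure Ω) (ξ : ∀ t, Ω → M.Ξ t) : Prop :=
  ∀ π, M.IsOptimal P ξ π → ∀ t < M.T, ∀ᵐ ω ∂P,
    M.IsSubOptimal κ (M.decisions π t (histOf ξ t ω)) (histOf ξ t ω) π

end Conditional

end Model

end PRO

end

noncomputable section

set_option linter.unusedSectionVars false

namespace PRO

/-! ### Shrinking countable compact covers -/

/-- A sequence of countable covers by compact sets which shrink to points. -/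
structure IsCellSystem {Q : Type*} [TopologicalSpace Q] (B : ℕ → ℕ → Set Q) : Prop where
  compact : ∀ n i, IsCompact (B n i)
  cover : ∀ n q, ∃ i, q ∈ B n i
  shrink : ∀ (φ i : ℕ → ℕ) (q : ℕ → Q) (a : Q), StrictMono φ → (∀ n, q n ∈ B (φ n) (i n)) →
    Tendsto q atTop (𝓝 a) → Tendsto (fun n => B (φ n) (i n)) atTop (𝓝 a).smallSets

theorem exists_isCellSystem (Q : Type*) [TopologicalSpace Q] [T2Space Q]
    [SecondCountableTopology Q] [LocallyCompactSpace Q] [Nonempty Q] :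
    ∃ B : ℕ → ℕ → Set Q, IsCellSystem B := by
  let _ : MetricSpace Q := TopologicalSpace.metrizableSpaceMetric Q
  have h1 : ∀ n : ℕ, ∃ B : ℕ → Set Q, (∀ i, IsCompact (B i)) ∧ (∀ q, ∃ i, q ∈ B i) ∧
      ∀ i, ∃ c, B i ⊆ Metric.ball c (1 / ((n : ℝ) + 1)) := by
    intro n
    have hpos : (0 : ℝ) < 1 / ((n : ℝ) + 1) := by positivity
    choose K hK hKb hKc using fun q : Q => local_compact_nhds (Metric.ball_mem_nhds q hpos)
    obtain ⟨s, hs, hcov⟩ := TopologicalSpace.countable_cover_nhds hK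
    have hne : s.Nonempty := by
      by_contra hne
      rw [Set.not_nonempty_iff_eq_empty] at hne
      subst hne
      simp only [Set.mem_empty_iff_false, Set.iUnion_of_empty, Set.iUnion_empty] at hcov
      exact Set.empty_ne_univ hcov
    obtain ⟨f, rfl⟩ := hs.exists_eq_range hne
    refine ⟨fun i => K (f i), fun i => hKc _, fun q => ?_, fun i => ⟨f i, hKb _⟩⟩
    have : q ∈ ⋃ x ∈ Set.range f, K x := hcov ▸ Set.mem_univ q
    simpa using this
  choose B hB1 hB2 hB3 using h1
  refine ⟨B, hB1, hB2, fun φ i q a hφ hq hqa => ?_⟩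
  rw [tendsto_smallSets_iff]
  intro t ht
  obtain ⟨ε, hε, hεt⟩ := Metric.mem_nhds_iff.1 ht
  have h2 : ∀ᶠ n in atTop, dist (q n) a < ε / 2 :=
    (Metric.tendsto_nhds.1 hqa) _ (by positivity)
  -- A cell lies in a ball of radius below `ε / 4`, so its points are within `ε / 2` of `q n`, which
  -- is itself within `ε / 2` of `a`.
  have h3 : ∀ᶠ n in atTop, 1 / ((φ n : ℝ) + 1) < ε / 4 :=
    ((tendsto_one_div_add_atTop_nhds_zero_nat (𝕜 := ℝ)).comp hφ.tendsto_atTop).eventually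
      (gt_mem_nhds (by positivity))
  filter_upwards [h2, h3] with n hn2 hn3
  intro x hx
  obtain ⟨c, hc⟩ := hB3 (φ n) (i n)
  have h4 := Metric.mem_ball.1 (hc hx)
  have h5 := Metric.mem_ball'.1 (hc (hq n))
  apply hεt
  rw [Metric.mem_ball]
  have h6 := dist_triangle4 x c (q n) a
  linarith

/-! ### Compact-valued measurable multifunctions -/

/-- A compact-valued multifunction for which the preimages of closed sets are measurable. -/
structure MeasCompact {Q S : Type*} [TopologicalSpace Q] [MeasurableSpace S]
    (A : S → Set Q) : Prop where
  compact : ∀ s, IsCompact (A s)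
  hit : ∀ C, IsClosed C → MeasurableSet {s | (C ∩ A s).Nonempty}

/-- The superlevel sets of `W` on `G` are compact-valued measurable multifunctions. -/
def NormalOn {Q S : Type*} [TopologicalSpace Q] [MeasurableSpace S]
    (G : S → Set Q) (W : Q → S → ℝ) : Prop :=
  ∀ a : ℝ, MeasCompact (fun s => {q | q ∈ G s ∧ a ≤ W q s})

section

variable {Q Y S S' : Type*} [TopologicalSpace Q] [TopologicalSpace Y]
  [MeasurableSpace S] [MeasurableSpace S']

theorem MeasCompact.comp {A : S → Set Q} (hA : MeasCompact A) {f : S' → S} (hf : Measurable f) :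
    MeasCompact (fun s => A (f s)) :=
  ⟨fun _ => hA.compact _, fun C hC => hf (hA.hit C hC)⟩

theorem MeasCompact.inter_closed {A : S → Set Q} (hA : MeasCompact A) {C : Set Q}
    (hC : IsClosed C) : MeasCompact (fun s => A s ∩ C) := by
  refine ⟨fun s => (hA.compact s).inter_right hC, fun D hD => ?_⟩
  convert hA.hit (D ∩ C) (hD.inter hC) using 4 with s
  rw [Set.inter_comm (A s), Set.inter_assoc]

theorem MeasCompact.measurableSet_nonempty {A : S → Set Q} (hA : MeasCompact A) :
    MeasurableSet {s | (A s).Nonempty} := by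
  simpa using hA.hit Set.univ isClosed_univ

theorem MeasCompact.image {A : S → Set Q} (hA : MeasCompact A) {f : Q → Y} (hf : Continuous f) :
    MeasCompact (fun s => f '' A s) := by
  refine ⟨fun s => (hA.compact s).image hf, fun C hC => ?_⟩
  convert hA.hit (f ⁻¹' C) (hC.preimage hf) using 3
  rw [Set.inter_comm C, ← Set.image_inter_preimage, Set.image_nonempty, Set.inter_comm]

theorem NormalOn.comp {G : S → Set Q} {W : Q → S → ℝ} (h : NormalOn G W) {f : S' → S}
    (hf : Measurable f) : NormalOn (fun s => G (f s)) (fun q s => W q (f s)) :=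
  fun a => (h a).comp hf

theorem NormalOn.inter_closed {G : S → Set Q} {W : Q → S → ℝ} (h : NormalOn G W) {C : Set Q}
    (hC : IsClosed C) : NormalOn (fun s => G s ∩ C) W := by
  intro a
  convert (h a).inter_closed hC using 2
  ext q
  simp only [Set.mem_inter_iff, Set.mem_ofPred_eq]
  tauto

/-- Each value is cut down to the first cell of the cover that it meets. The index of that cell is a
measurable function because hitting a cell is a measurable event. Iteration yields a measurable
selection. -/
theorem MeasCompact.exists_refinement {A : S → Set Q} (hA : MeasCompact A)
    (hne : ∀ s, (A s).Nonempty) {B : ℕ → Set Q} (hB : ∀ i, IsClosed (B i))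
    (hcov : ∀ q, ∃ i, q ∈ B i) :
    ∃ A' : S → Set Q, MeasCompact A' ∧ (∀ s, (A' s).Nonempty) ∧ (∀ s, A' s ⊆ A s) ∧
      ∀ s, ∃ i, A' s ⊆ B i := by
  classical
  have hex : ∀ s, ∃ i, (B i ∩ A s).Nonempty := fun s => by
    obtain ⟨q, hq⟩ := hne s
    obtain ⟨i, hi⟩ := hcov q
    exact ⟨i, q, hi, hq⟩
  have hmeas : Measurable (fun s => Nat.find (hex s)) :=
    measurable_find _ fun i => hA.hit _ (hB i)
  refine ⟨fun s => A s ∩ B (Nat.find (hex s)), ⟨fun s => (hA.compact s).inter_right (hB _),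
    fun C hC => ?_⟩, fun s => ?_, fun s => Set.inter_subset_left,
    fun s => ⟨_, Set.inter_subset_right⟩⟩
  · have key : {s | (C ∩ (A s ∩ B (Nat.find (hex s)))).Nonempty} =
        ⋃ i, ((fun s => Nat.find (hex s)) ⁻¹' {i} ∩ {s | ((C ∩ B i) ∩ A s).Nonempty}) := by
      ext s
      simp only [Set.mem_iUnion, Set.mem_inter_iff, Set.mem_preimage, Set.mem_singleton_iff,
        Set.mem_ofPred_eq, exists_eq_left']
      rw [Set.inter_comm (A s), Set.inter_assoc]
    rw [key]
    exact MeasurableSet.iUnion fun i => (hmeas (measurableSet_singleton i)).inter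
      (hA.hit _ (hC.inter (hB i)))
  · obtain ⟨q, hqB, hqA⟩ := Nat.find_spec (hex s)
    exact ⟨q, hqA, hqB⟩

variable [T2Space Q]

theorem NormalOn.upperSemicontinuousOn {G : S → Set Q} {W : Q → S → ℝ} (h : NormalOn G W) (s : S) :
    UpperSemicontinuousOn (fun q => W q s) (G s) := by
  rw [upperSemicontinuousOn_iff_preimage_Ici]
  intro a
  refine ⟨_, ((h a).compact s).isClosed, ?_⟩
  ext q
  simp

theorem NormalOn.exists_max {G : S → Set Q} {W : Q → S → ℝ} (h : NormalOn G W)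
    (hG : MeasCompact G) {s : S} (hs : (G s).Nonempty) :
    ∃ q ∈ G s, ∀ q' ∈ G s, W q' s ≤ W q s :=
  (h.upperSemicontinuousOn s).exists_isMaxOn hs (hG.compact s)

/-- The maximum is attained, so it is at least `a` exactly when the superlevel set is nonempty.
Where `G s` is empty the supremum is `0` by convention, which accounts for the second set in the
union. -/
theorem NormalOn.measurable_sSup {G : S → Set Q} {W : Q → S → ℝ} (h : NormalOn G W)
    (hG : MeasCompact G) : Measurable (fun s => sSup ((fun q => W q s) '' G s)) := by
  refine measurable_of_Ici fun a => ?_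
  have key : (fun s => sSup ((fun q => W q s) '' G s)) ⁻¹' Set.Ici a =
      {s | ({q | q ∈ G s ∧ a ≤ W q s}).Nonempty} ∪ ({s | (G s).Nonempty}ᶜ ∩ {_s | a ≤ 0}) := by
    ext s
    by_cases hs : (G s).Nonempty
    · obtain ⟨q, hq, hmax⟩ := h.exists_max hG hs
      have hgr : IsGreatest ((fun q => W q s) '' G s) (W q s) :=
        ⟨⟨q, hq, rfl⟩, by rintro _ ⟨q', hq', rfl⟩; exact hmax q' hq'⟩
      simp only [Set.mem_preimage, hgr.csSup_eq, Set.mem_Ici, Set.mem_union, Set.mem_inter_iff,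
        Set.mem_compl_iff, Set.mem_ofPred_eq, hs, not_true_eq_false, false_and, or_false]
      exact ⟨fun ha => ⟨q, hq, ha⟩, fun ⟨q', hq', ha⟩ => ha.trans (hmax q' hq')⟩
    · rw [Set.not_nonempty_iff_eq_empty] at hs
      simp [hs]
  rw [key]
  exact (h a).measurableSet_nonempty.union (hG.measurableSet_nonempty.compl.inter (.const _))

/-- Used with the maximal value as threshold, which turns the superlevel set into the set of
maximizers. A measurable threshold reduces to its rational minorants, since a maximizer over `G s ∩
C` reaches every level that is reached at all. -/
theorem NormalOn.threshold {G : S → Set Q} {W : Q → S → ℝ} (h : NormalOn G W)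
    (hG : MeasCompact G) {m : S → ℝ} (hm : Measurable m) :
    MeasCompact (fun s => {q | q ∈ G s ∧ m s ≤ W q s}) := by
  refine ⟨fun s => (h (m s)).compact s, fun C hC => ?_⟩
  have key : {s | (C ∩ {q | q ∈ G s ∧ m s ≤ W q s}).Nonempty} =
      ⋂ r : ℚ, ({s | m s ≤ r} ∪ {s | (C ∩ {q | q ∈ G s ∧ (r : ℝ) ≤ W q s}).Nonempty}) := by
    ext s
    simp only [Set.mem_iInter, Set.mem_union, Set.mem_ofPred_eq]
    constructor
    · rintro ⟨q, hqC, hqG, hq⟩ r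
      rcases le_total (m s) r with hr | hr
      · exact Or.inl hr
      · exact Or.inr ⟨q, hqC, hqG, hr.trans hq⟩
    · intro hr
      have hhit : ∀ r : ℚ, (r : ℝ) < m s → (C ∩ {q | q ∈ G s ∧ (r : ℝ) ≤ W q s}).Nonempty :=
        fun r hlt => (hr r).resolve_left (not_le.2 hlt)
      obtain ⟨r₀, hr₀⟩ := exists_rat_lt (m s)
      obtain ⟨q₀, hq₀C, hq₀G, -⟩ := hhit r₀ hr₀
      obtain ⟨q, ⟨hqG, hqC⟩, hmax⟩ := (h.inter_closed hC).exists_max (hG.inter_closed hC)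
        (s := s) ⟨q₀, hq₀G, hq₀C⟩
      refine ⟨q, hqC, hqG, ?_⟩
      by_contra! hlt
      obtain ⟨r, hr1, hr2⟩ := exists_rat_btwn hlt
      obtain ⟨q', hq'C, hq'G, hq'⟩ := hhit r hr2
      exact absurd (hmax q' ⟨hq'G, hq'C⟩) (not_le.2 (hr1.trans_le hq'))
  rw [key]
  exact MeasurableSet.iInter fun r => (measurableSet_le hm measurable_const).union ((h r).hit C hC)

variable [SecondCountableTopology Q] [LocallyCompactSpace Q]

/-- A submultifunction of a compact-valued measurable multifunction is again measurable and
compact-valued if the hitting of small compact sets can be tested by measurable conditions. -/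
theorem MeasCompact.of_approx {G A : S → Set Q} (hG : MeasCompact G)
    (hAG : ∀ s, A s ⊆ G s) (Θ : Set Q → Set S)
    (hΘ : ∀ K, IsCompact K → MeasurableSet (Θ K))
    (h1 : ∀ K, IsCompact K → ∀ s, (K ∩ A s).Nonempty → s ∈ Θ K)
    (h2 : ∀ (K : ℕ → Set Q) (s : S) (a : Q), (∀ n, IsCompact (K n)) →
      (∀ n, (K n ∩ G s).Nonempty) → a ∈ G s → Tendsto K atTop (𝓝 a).smallSets →
      (∀ n, s ∈ Θ (K n)) → a ∈ A s) :
    MeasCompact A := by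
  refine ⟨fun s => (hG.compact s).of_isClosed_subset ?_ (hAG s), fun C hC => ?_⟩
  · refine IsSeqClosed.isClosed fun q a hq hqa => ?_
    refine h2 (fun n => {q n}) s a (fun n => isCompact_singleton)
      (fun n => ⟨q n, rfl, hAG s (hq n)⟩)
      ((hG.compact s).isClosed.isSeqClosed (fun n => hAG s (hq n)) hqa) ?_
      (fun n => h1 _ isCompact_singleton s ⟨q n, rfl, hq n⟩)
    rw [tendsto_smallSets_iff]
    intro t ht
    filter_upwards [hqa ht] with n hn
    exact Set.singleton_subset_iff.2 hn
  · rcases isEmpty_or_nonempty Q with hQ | hQ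
    · have : {s | (C ∩ A s).Nonempty} = ∅ := by
        ext s
        simp [Set.eq_empty_of_isEmpty]
      rw [this]
      exact .empty
    obtain ⟨B, hB⟩ := exists_isCellSystem Q
    -- At each scale some cell passes the test. Points of `G s` in these cells accumulate at some
    -- `a` by compactness, the cells shrink to `a` along a subsequence, and `h2` places `a` in `A
    -- s`.
    have key : {s | (C ∩ A s).Nonempty} = ⋂ n, ⋃ i,
        ({s | ((C ∩ B n i) ∩ G s).Nonempty} ∩ Θ (C ∩ B n i)) := by
      ext s
      simp only [Set.mem_iInter, Set.mem_iUnion, Set.mem_inter_iff, Set.mem_ofPred_eq]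
      constructor
      · rintro ⟨q, hqC, hqA⟩ n
        obtain ⟨i, hi⟩ := hB.cover n q
        exact ⟨i, ⟨q, ⟨hqC, hi⟩, hAG s hqA⟩,
          h1 _ ((hB.compact n i).inter_left hC) s ⟨q, ⟨hqC, hi⟩, hqA⟩⟩
      · intro h
        choose i hi hΘi using h
        choose q hq hqG using hi
        obtain ⟨a, haG, φ, hφ, hlim⟩ :=
          ((hG.compact s).inter_left hC).tendsto_subseq (x := q) fun n => ⟨(hq n).1, hqG n⟩
        refine ⟨a, haG.1, h2 (fun n => C ∩ B (φ n) (i (φ n))) s a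
          (fun n => (hB.compact _ _).inter_left hC) (fun n => ⟨q (φ n), hq _, hqG _⟩) haG.2 ?_
          fun n => hΘi _⟩
        exact (hB.shrink φ (fun n => i (φ n)) (q ∘ φ) a hφ (fun n => (hq _).2) hlim).smallSets_mono
          (Eventually.of_forall fun n => Set.inter_subset_right)
    rw [key]
    exact MeasurableSet.iInter fun n => MeasurableSet.iUnion fun i =>
      (hG.hit _ (hC.inter (hB.compact n i).isClosed)).inter (hΘ _ ((hB.compact n i).inter_left hC))

/-- The intersection of a compact-valued measurable multifunction with a closed-valued one. -/
theorem MeasCompact.inter {G H : S → Set Q} (hG : MeasCompact G) (hH : ∀ s, IsClosed (H s))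
    (hHm : ∀ C, IsClosed C → MeasurableSet {s | (C ∩ H s).Nonempty}) :
    MeasCompact (fun s => G s ∩ H s) := by
  refine hG.of_approx (fun s => Set.inter_subset_left) (fun K => {s | (K ∩ H s).Nonempty})
    (fun K hK => hHm K hK.isClosed) (fun K _ s => ?_) fun K s a _ _ haG hK hit => ⟨haG, ?_⟩
  · rintro ⟨q, hqK, -, hqH⟩
    exact ⟨q, hqK, hqH⟩
  · by_contra ha
    have := tendsto_smallSets_iff.1 hK _ ((hH s).isOpen_compl.mem_nhds ha)
    obtain ⟨n, hn⟩ := this.exists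
    obtain ⟨q, hqK, hqH⟩ := hit n
    exact hn hqK hqH

/-- A point lies off the closed set `A s` exactly when one of the countably many cells contains it
and misses `A s`, so the complement of the graph is a countable union of measurable rectangles. -/
theorem MeasCompact.measurableSet_graph [MeasurableSpace Q] [OpensMeasurableSpace Q]
    {A : S → Set Q} (hA : MeasCompact A) : MeasurableSet {p : Q × S | p.1 ∈ A p.2} := by
  rcases isEmpty_or_nonempty Q with hQ | hQ
  · rw [Set.eq_empty_of_isEmpty {p : Q × S | p.1 ∈ A p.2}]
    exact .empty
  obtain ⟨B, hB⟩ := exists_isCellSystem Q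
  have key : {p : Q × S | p.1 ∈ A p.2}ᶜ =
      ⋃ n, ⋃ i, B n i ×ˢ {s | (B n i ∩ A s).Nonempty}ᶜ := by
    ext ⟨q, s⟩
    simp only [Set.mem_compl_iff, Set.mem_ofPred_eq, Set.mem_iUnion, Set.mem_prod]
    constructor
    · intro hq
      choose i hi using fun n => hB.cover n q
      have h3 := hB.shrink id i (fun _ => q) q strictMono_id hi tendsto_const_nhds
      obtain ⟨n, hn⟩ := (tendsto_smallSets_iff.1 h3 _
        ((hA.compact s).isClosed.isOpen_compl.mem_nhds hq)).exists
      refine ⟨n, i n, hi n, ?_⟩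
      rintro ⟨x, hxB, hxA⟩
      exact hn hxB hxA
    · rintro ⟨n, i, hqB, hn⟩ hq
      exact hn ⟨q, hqB, hq⟩
  rw [← MeasurableSet.compl_iff, key]
  exact MeasurableSet.iUnion fun n => MeasurableSet.iUnion fun i =>
    (hB.compact n i).measurableSet.prod (hA.hit _ (hB.compact n i).isClosed).compl

/-- The section of a multifunction into a product is measurable in the first variable and the
parameter together. -/
theorem MeasCompact.prodSection [MeasurableSpace Q] [OpensMeasurableSpace Q]
    {A : S → Set (Q × Y)} (hA : MeasCompact A) :
    MeasCompact (fun p : Q × S => {y | (p.1, y) ∈ A p.2}) := by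
  constructor
  · intro p
    have := ((hA.compact p.2).inter_right
      ((isClosed_singleton (x := p.1)).preimage continuous_fst)).image continuous_snd
    convert this using 1
    ext y
    constructor
    · intro hy
      exact ⟨(p.1, y), ⟨hy, rfl⟩, rfl⟩
    · rintro ⟨⟨x, y⟩, ⟨h, hx⟩, rfl⟩
      obtain rfl : x = p.1 := hx
      exact h
  · intro C hC
    -- The section at `q` meets `C` exactly when `q` lies in the projection of `A s ∩ (Q × C)`, so
    -- the measurable graph of this projection is what is needed.
    have := ((hA.inter_closed (hC.preimage continuous_snd)).image
      continuous_fst).measurableSet_graph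
    convert this using 1
    ext p
    constructor
    · rintro ⟨y, hyC, hy⟩
      exact ⟨(p.1, y), ⟨hy, hyC⟩, rfl⟩
    · rintro ⟨⟨x, y⟩, ⟨h, hy⟩, hx⟩
      obtain rfl : x = p.1 := hx
      exact ⟨y, hy, h⟩

theorem NormalOn.prodSection [MeasurableSpace Q] [OpensMeasurableSpace Q]
    {G : S → Set (Q × Y)} {W : Q × Y → S → ℝ} (h : NormalOn G W) :
    NormalOn (fun p : Q × S => {y | (p.1, y) ∈ G p.2}) (fun y p => W (p.1, y) p.2) :=
  fun a => (h a).prodSection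

/-- Measurable selection for nonempty compact values. -/
theorem MeasCompact.exists_selection_of_nonempty [MeasurableSpace Q] [BorelSpace Q] [Nonempty Q]
    {A : S → Set Q} (hA : MeasCompact A) (hne : ∀ s, (A s).Nonempty) :
    ∃ σ : S → Q, Measurable σ ∧ ∀ s, σ s ∈ A s := by
  obtain ⟨B, hB⟩ := exists_isCellSystem Q
  let 𝒜 := {A' : S → Set Q // MeasCompact A' ∧ ∀ s, (A' s).Nonempty}
  have hstep : ∀ (n : ℕ) (A₁ : 𝒜), ∃ A₂ : 𝒜, (∀ s, A₂.1 s ⊆ A₁.1 s) ∧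
      ∀ s, ∃ i, A₂.1 s ⊆ B n i := by
    intro n A₁
    obtain ⟨A', h1, h2, h3, h4⟩ := A₁.2.1.exists_refinement A₁.2.2
      (fun i => (hB.compact n i).isClosed) (hB.cover n)
    exact ⟨⟨A', h1, h2⟩, h3, h4⟩
  choose next hsub hcell using hstep
  -- Repeated refinement gives nested compact values, the `n`-th contained in a cell of level `n -
  -- 1`. Their intersection is a single point, and this point is the selection.
  let D : ℕ → 𝒜 := fun n => Nat.rec ⟨A, hA, hne⟩ next n
  have hD : ∀ n s, (D (n + 1)).1 s ⊆ (D n).1 s := fun n s => hsub n (D n) s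
  have hDB : ∀ n s, ∃ i, (D (n + 1)).1 s ⊆ B n i := fun n s => hcell n (D n) s
  have hinter : ∀ s, (⋂ n, (D n).1 s).Nonempty := fun s =>
    IsCompact.nonempty_iInter_of_sequence_nonempty_isCompact_isClosed _ (fun n => hD n s)
      (fun n => (D n).2.2 s) ((D 0).2.1.compact s) fun n => ((D n).2.1.compact s).isClosed
  choose σ hσ using hinter
  have huniq : ∀ s q, q ∈ ⋂ n, (D n).1 s → q = σ s := by
    intro s q hq
    by_contra hqne
    choose i hi using fun n => hDB n s
    have hlim := hB.shrink id i (fun _ => q) q strictMono_id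
      (fun n => hi n (Set.mem_iInter.1 hq (n + 1))) tendsto_const_nhds
    obtain ⟨n, hn⟩ := (tendsto_smallSets_iff.1 hlim _
      ((isOpen_compl_singleton (x := σ s)).mem_nhds hqne)).exists
    exact hn (hi n (Set.mem_iInter.1 (hσ s) (n + 1))) rfl
  refine ⟨σ, measurable_of_isClosed fun C hC => ?_, fun s => Set.mem_iInter.1 (hσ s) 0⟩
  have key : σ ⁻¹' C = ⋂ n, {s | (C ∩ (D n).1 s).Nonempty} := by
    ext s
    simp only [Set.mem_preimage, Set.mem_iInter, Set.mem_ofPred_eq]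
    constructor
    · intro h n
      exact ⟨σ s, h, Set.mem_iInter.1 (hσ s) n⟩
    · intro h
      obtain ⟨q, hq⟩ := IsCompact.nonempty_iInter_of_sequence_nonempty_isCompact_isClosed
        (fun n => C ∩ (D n).1 s) (fun n => Set.inter_subset_inter_right _ (hD n s)) h
        (((D 0).2.1.compact s).inter_left hC)
        fun n => hC.inter ((D n).2.1.compact s).isClosed
      rw [Set.mem_iInter] at hq
      rw [← huniq s q (Set.mem_iInter.2 fun n => (hq n).2)]
      exact (hq 0).1
  rw [key]
  exact MeasurableSet.iInter fun n => (D n).2.1.hit C hC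

/-- Measurable selection wherever the value is nonempty. -/
theorem MeasCompact.exists_selection [MeasurableSpace Q] [BorelSpace Q] [Nonempty Q]
    {A : S → Set Q} (hA : MeasCompact A) :
    ∃ σ : S → Q, Measurable σ ∧ ∀ s, (A s).Nonempty → σ s ∈ A s := by
  classical
  have q₀ : Q := Classical.arbitrary Q
  have hM := hA.measurableSet_nonempty
  have hA' : MeasCompact (fun s => if (A s).Nonempty then A s else {q₀}) := by
    refine ⟨fun s => ?_, fun C hC => ?_⟩
    · split_ifs
      exacts [hA.compact s, isCompact_singleton]
    · have key : {s | (C ∩ if (A s).Nonempty then A s else {q₀}).Nonempty} =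
          {s | (C ∩ A s).Nonempty} ∪ ({s | (A s).Nonempty}ᶜ ∩ {_s | q₀ ∈ C}) := by
        ext s
        by_cases hs : (A s).Nonempty
        · simp [hs]
        · rw [Set.not_nonempty_iff_eq_empty] at hs
          simp [hs]
      rw [key]
      exact (hA.hit C hC).union (hM.compl.inter (.const _))
  obtain ⟨σ, hσ, hσA⟩ := hA'.exists_selection_of_nonempty fun s => by
    split_ifs with hs
    exacts [hs, Set.singleton_nonempty _]
  refine ⟨σ, hσ, fun s hs => ?_⟩
  simpa [hs] using hσA s

end

/-! ### Limits of utilities and of integrals -/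

theorem IsUtility.measurable {u : ℝ → ℝ} (h : IsUtility u) : Measurable u :=
  h.monotone.measurable

/-- If `v j y ≥ u y + ε`, monotonicity keeps `v j` above this level to the right of `y`, while upper
semicontinuity keeps `u` below `u y + ε / 2` on an interval there. The `L^p` distance is then
bounded below by the fixed positive number `m`. -/
theorem UtilTendsto.eventually_lt {p : ℝ≥0∞} (hp : 0 < p) {v : ℕ → ℝ → ℝ} {u : ℝ → ℝ}
    (h : UtilTendsto p v u) (hv : ∀ j, Monotone (v j)) (hu : UpperSemicontinuous u)
    (y : ℝ) {ε : ℝ} (hε : 0 < ε) : ∀ᶠ j in atTop, v j y < u y + ε := by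
  have h1 : ∀ᶠ y' in 𝓝 y, u y' < u y + ε / 2 := hu y _ (by linarith)
  obtain ⟨δ, hδ, hball⟩ := Metric.eventually_nhds_iff.1 h1
  set I := Set.Icc y (y + δ / 2) with hI
  have hsub : I ⊆ Set.Icc (-(|y| + δ)) (|y| + δ) := fun x hx =>
    ⟨by linarith [hx.1, neg_abs_le y], by linarith [hx.2, le_abs_self y]⟩
  set m := eLpNorm (fun _ : ℝ => ε / 2) p (volume.restrict I) with hm
  have hvol : volume.restrict I ≠ 0 := by
    rw [Ne, Measure.restrict_eq_zero, hI, Real.volume_Icc]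
    simp [hδ]
  have hmpos : 0 < m := by
    rw [hm, pos_iff_ne_zero, Ne, eLpNorm_eq_zero_iff (by fun_prop) hp.ne']
    intro h0
    have : ∀ᵐ _ ∂(volume.restrict I), False := by
      filter_upwards [h0] with x hx
      simp only [Pi.zero_apply] at hx
      linarith
    rw [eventually_false_iff_eq_bot, ae_eq_bot] at this
    exact hvol this
  filter_upwards [(h (|y| + δ)).eventually (gt_mem_nhds hmpos)] with j hj
  by_contra! hlt
  refine absurd hj (not_lt.2 ?_)
  calc m ≤ eLpNorm (fun x => v j x - u x) p (volume.restrict I) := by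
        refine eLpNorm_mono_ae ?_
        refine (ae_restrict_iff' measurableSet_Icc).2 (Eventually.of_forall fun x hx => ?_)
        have h2 : u x < u y + ε / 2 := hball (by
          rw [Real.dist_eq, abs_of_nonneg (by linarith [hx.1])]
          linarith [hx.2])
        have h3 := hv j hx.1
        rw [Real.norm_eq_abs, Real.norm_eq_abs, abs_of_pos (by linarith),
          abs_of_nonneg (by linarith)]
        linarith
    _ ≤ _ := eLpNorm_mono_measure _ (Measure.restrict_mono hsub le_rfl)

/-- A reverse Fatou lemma: `max (f n) F` converges to `F` pointwise and is dominated by `g`. -/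
theorem le_integral_of_eventually_lt {Z : Type*} [MeasurableSpace Z] {μ : Measure Z}
    {f : ℕ → Z → ℝ} {F g : Z → ℝ} (hf : ∀ n, Measurable (f n)) (hF : Measurable F)
    (hg : Integrable g μ) (hfg : ∀ n z, |f n z| ≤ g z) (hFg : ∀ z, |F z| ≤ g z)
    (hlim : ∀ z, ∀ ε > 0, ∀ᶠ n in atTop, f n z < F z + ε)
    {a : ℝ} (ha : ∀ n, a ≤ ∫ z, f n z ∂μ) : a ≤ ∫ z, F z ∂μ := by
  have hlim' : Tendsto (fun n => ∫ z, max (f n z) (F z) ∂μ) atTop (𝓝 (∫ z, F z ∂μ)) := by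
    refine tendsto_integral_of_dominated_convergence g
      (fun n => ((hf n).max hF).aestronglyMeasurable) hg
      (fun n => Eventually.of_forall fun z => ?_) (Eventually.of_forall fun z => ?_)
    · rw [Real.norm_eq_abs]
      exact abs_max_le_max_abs_abs.trans (max_le (hfg n z) (hFg z))
    · rw [Metric.tendsto_nhds]
      intro ε hε
      filter_upwards [hlim z ε hε] with n hn
      rw [Real.dist_eq, abs_of_nonneg (sub_nonneg.2 (le_max_right _ _)), sub_lt_iff_lt_add']
      exact max_lt hn (by linarith)
  refine ge_of_tendsto' hlim' fun n => (ha n).trans ?_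
  refine integral_mono ?_ ?_ fun z => le_max_left _ _
  · exact hg.mono' (hf n).aestronglyMeasurable (Eventually.of_forall fun z => hfg n z)
  · exact hg.mono' ((hf n).max hF).aestronglyMeasurable (Eventually.of_forall fun z =>
      abs_max_le_max_abs_abs.trans (max_le (hfg n z) (hFg z)))

/-- The worst-case expectation over a set of utilities is that over a dense sequence. -/
theorem iInf_integral_eq_iInf_nat {Z : Type*} [MeasurableSpace Z] {μ : Measure Z}
    [IsProbabilityMeasure μ] {p : ℝ≥0∞} (hp : 0 < p) {U : Set (ℝ → ℝ)}
    (hU : ∀ u ∈ U, IsUtility u) {b : ℝ} (hb : ∀ u ∈ U, ∀ y, |u y| ≤ b) {v : ℕ → ℝ → ℝ}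
    (hvU : ∀ k, v k ∈ U) (hdense : ∀ u ∈ U, ∃ φ : ℕ → ℕ, UtilTendsto p (fun j => v (φ j)) u)
    {f : Z → ℝ} (hf : Measurable f) :
    ⨅ u : U, ∫ z, u.1 (f z) ∂μ = ⨅ k, ∫ z, v k (f z) ∂μ := by
  have hbd : ∀ u ∈ U, -b ≤ ∫ z, u (f z) ∂μ := fun u hu => by
    have := norm_integral_le_of_norm_le_const (μ := μ) (f := fun z => u (f z)) (C := b)
      (Eventually.of_forall fun z => hb u hu _)
    rw [probReal_univ, mul_one] at this
    exact (abs_le.1 this).1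
  have hbdd : BddBelow (Set.range fun u : U => ∫ z, u.1 (f z) ∂μ) :=
    ⟨-b, by rintro _ ⟨u, rfl⟩; exact hbd u.1 u.2⟩
  have hbddv : BddBelow (Set.range fun k => ∫ z, v k (f z) ∂μ) :=
    ⟨-b, by rintro _ ⟨k, rfl⟩; exact hbd _ (hvU k)⟩
  have : Nonempty U := ⟨⟨v 0, hvU 0⟩⟩
  -- Only the bound of the sequence's infimum by a given `u` needs density: approximating utilities
  -- do not exceed `u` in the limit, at any point.
  refine le_antisymm (le_ciInf fun k => ciInf_le hbdd ⟨v k, hvU k⟩) (le_ciInf fun u => ?_)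
  obtain ⟨φ, hφ⟩ := hdense u.1 u.2
  refine le_integral_of_eventually_lt (f := fun j z => v (φ j) (f z)) (g := fun _ => b)
    (fun j => (hU _ (hvU _)).measurable.comp hf) ((hU _ u.2).measurable.comp hf)
    (integrable_const b) (fun j z => hb _ (hvU _) _) (fun z => hb _ u.2 _) (fun z ε hε => ?_)
    fun j => ciInf_le hbddv _
  exact hφ.eventually_lt hp (fun j => (hU _ (hvU _)).monotone) (hU _ u.2).usc _ hε

/-! ### The one-stage objective and the feasible sets -/

section

variable {Q S Z : Type*} [TopologicalSpace Q] [MeasurableSpace S] [T2Space Q]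
  [SecondCountableTopology Q] [LocallyCompactSpace Q]

/-- The superlevel sets are obtained from `MeasCompact.of_approx`. Whether a small compact set meets
one is tested by a countable family of integral inequalities, with the arguments of the integrand
replaced by suprema over the set. -/
theorem NormalOn.iInf_integral_add [TopologicalSpace Z] [MeasurableSpace Z]
    [OpensMeasurableSpace Z] {κ : Kernel S Z} [IsMarkovKernel κ] {h : Q × Z → ℝ}
    (hh : Continuous h) {v : ℕ → S → ℝ → ℝ}
    (hvm : ∀ k, Measurable (fun q : S × ℝ => v k q.1 q.2)) (hvu : ∀ k s, IsUtility (v k s))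
    {b : S → ℝ} (hvb : ∀ k s y, |v k s y| ≤ b s) {G : S → Set Q} (hG : MeasCompact G)
    {W : Q → S × Z → ℝ} (hW : NormalOn (fun p : S × Z => G p.1) W)
    (hWm : ∀ q s, Measurable (fun z => W q (s, z))) {β : S × Z → ℝ}
    (hWβ : ∀ q p, |W q p| ≤ β p) (hβ : ∀ s, Integrable (fun z => β (s, z)) (κ s)) :
    NormalOn G (fun q s => ⨅ k, ∫ z, (v k s (h (q, z)) + W q (s, z)) ∂κ s) := by
  have hGc : MeasCompact (fun p : S × Z => G p.1) := hG.comp measurable_fst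
  have hgi : ∀ s, Integrable (fun z => b s + β (s, z)) (κ s) :=
    fun s => (integrable_const _).add (hβ s)
  have hhq : ∀ q, Measurable (fun z => h (q, z)) := fun q => by
    have : Continuous fun z => h (q, z) := by fun_prop
    exact this.measurable
  have hfm : ∀ q k s, Measurable (fun z => v k s (h (q, z)) + W q (s, z)) :=
    fun q k s => ((hvu k s).measurable.comp (hhq q)).add (hWm q s)
  have hfb : ∀ q k s z, |v k s (h (q, z)) + W q (s, z)| ≤ b s + β (s, z) :=
    fun q k s z => (abs_add_le _ _).trans (add_le_add (hvb _ _ _) (hWβ _ _))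
  have hfi : ∀ q k s, Integrable (fun z => v k s (h (q, z)) + W q (s, z)) (κ s) :=
    fun q k s => (hgi s).mono' (hfm q k s).aestronglyMeasurable
      (Eventually.of_forall fun z => hfb q k s z)
  have hbdd : ∀ q s,
      BddBelow (Set.range fun k => ∫ z, (v k s (h (q, z)) + W q (s, z)) ∂κ s) := by
    intro q s
    refine ⟨-∫ z, (b s + β (s, z)) ∂κ s, ?_⟩
    rintro _ ⟨k, rfl⟩
    rw [← integral_neg]
    exact integral_mono (hgi s).neg (hfi q k s) fun z => (abs_le.1 (hfb q k s z)).1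
  -- Suprema over `K` of the reward and of the cost-to-go. The second runs over `G p.1 ∩ K` because
  -- `W` is upper semicontinuous only on `G`. Monotone utilities make the test with `H` and `w`
  -- weaker than the condition at any point of `G s ∩ K`.
  let H : Set Q → Z → ℝ := fun K z => sSup ((fun q => h (q, z)) '' K)
  let w : Set Q → S × Z → ℝ := fun K p => sSup ((fun q => W q p) '' (G p.1 ∩ K))
  have hHm : ∀ K, IsCompact K → Measurable (H K) := fun K hK =>
    (hK.continuous_sSup (f := fun z q => h (q, z)) (by fun_prop)).measurable
  have hHmax : ∀ K, IsCompact K → K.Nonempty → ∀ z, ∃ q ∈ K, H K z = h (q, z) ∧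
      ∀ q' ∈ K, h (q', z) ≤ H K z := by
    intro K hK hne z
    obtain ⟨q, hq, h1, h2⟩ := hK.exists_sSup_image_eq_and_ge hne
      (f := fun q => h (q, z)) (by fun_prop)
    exact ⟨q, hq, h1, fun q' hq' => (h2 q' hq').trans h1.ge⟩
  have hwm : ∀ K, IsCompact K → Measurable (w K) := fun K hK =>
    (hW.inter_closed hK.isClosed).measurable_sSup (hGc.inter_closed hK.isClosed)
  have hwmax : ∀ K, IsCompact K → ∀ s z, (G s ∩ K).Nonempty → ∃ q ∈ G s ∩ K,
      w K (s, z) = W q (s, z) ∧ ∀ q' ∈ G s ∩ K, W q' (s, z) ≤ w K (s, z) := by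
    intro K hK s z hne
    obtain ⟨q, hq, hmax⟩ := (hW.inter_closed hK.isClosed).exists_max
      (hGc.inter_closed hK.isClosed) (s := (s, z)) hne
    have hgr : IsGreatest ((fun q => W q (s, z)) '' (G s ∩ K)) (W q (s, z)) :=
      ⟨⟨q, hq, rfl⟩, by rintro _ ⟨q', hq', rfl⟩; exact hmax q' hq'⟩
    have : w K (s, z) = W q (s, z) := hgr.csSup_eq
    exact ⟨q, hq, this, fun q' hq' => (hmax q' hq').trans this.ge⟩
  have hΦm : ∀ K, IsCompact K → ∀ k s,
      Measurable (fun z => v k s (H K z) + w K (s, z)) := fun K hK k s =>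
    ((hvu k s).measurable.comp (hHm K hK)).add ((hwm K hK).comp measurable_prodMk_left)
  have hΦb : ∀ K, IsCompact K → ∀ k s z, (G s ∩ K).Nonempty →
      |v k s (H K z) + w K (s, z)| ≤ b s + β (s, z) := by
    intro K hK k s z hne
    obtain ⟨q, -, hq, -⟩ := hwmax K hK s z hne
    rw [hq]
    exact (abs_add_le _ _).trans (add_le_add (hvb _ _ _) (hWβ _ _))
  intro a
  refine hG.of_approx (fun s q hq => hq.1)
    (fun K => {s | ∀ k, a ≤ ∫ z, (v k s (H K z) + w K (s, z)) ∂κ s}) ?_ ?_ ?_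
  · intro K hK
    have : {s | ∀ k, a ≤ ∫ z, (v k s (H K z) + w K (s, z)) ∂κ s} =
        ⋂ k, {s | a ≤ ∫ z, (v k s (H K z) + w K (s, z)) ∂κ s} := by
      ext s
      simp
    rw [this]
    refine MeasurableSet.iInter fun k => measurableSet_le measurable_const ?_
    refine (StronglyMeasurable.integral_kernel_prod_right'
      (f := fun p : S × Z => v k p.1 (H K p.2) + w K p) ?_).measurable
    refine Measurable.stronglyMeasurable (Measurable.add ?_ (hwm K hK))
    exact (hvm k).comp (measurable_fst.prodMk ((hHm K hK).comp measurable_snd))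
  · rintro K hK s ⟨q, hqK, hqG, hq⟩ k
    refine (hq.trans (ciInf_le (hbdd q s) k)).trans ?_
    refine integral_mono (hfi q k s) ((hgi s).mono' (hΦm K hK k s).aestronglyMeasurable
      (Eventually.of_forall fun z => hΦb K hK k s z ⟨q, hqG, hqK⟩)) fun z => ?_
    obtain ⟨-, -, -, h1⟩ := hHmax K hK ⟨q, hqK⟩ z
    obtain ⟨-, -, -, h2⟩ := hwmax K hK s z ⟨q, hqG, hqK⟩
    exact add_le_add ((hvu k s).monotone (h1 q hqK)) (h2 q ⟨hqG, hqK⟩)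
  · intro K s q hK hne hqG hlim hΘ
    refine ⟨hqG, le_ciInf fun k => ?_⟩
    have hne' : ∀ n, (G s ∩ K n).Nonempty := fun n => by
      rw [Set.inter_comm]
      exact hne n
    refine le_integral_of_eventually_lt (g := fun z => b s + β (s, z))
      (fun n => hΦm (K n) (hK n) k s) (hfm q k s) (hgi s)
      (fun n z => hΦb (K n) (hK n) k s z (hne' n)) (fun z => hfb q k s z)
      (fun z ε hε => ?_) (fun n => hΘ n k)
    have hcont : Continuous fun q' => h (q', z) := by fun_prop
    have h1 : ∀ᶠ q' in 𝓝 q, v k s (h (q', z)) < v k s (h (q, z)) + ε / 2 :=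
      hcont.continuousAt.eventually ((hvu k s).usc (h (q, z)) _ (by linarith))
    have h2 : ∀ᶠ q' in 𝓝[G s] q, W q' (s, z) < W q (s, z) + ε / 2 :=
      hW.upperSemicontinuousOn (s, z) q hqG _ (by linarith)
    rw [eventually_nhdsWithin_iff] at h2
    -- For `n` large the whole of `K n` lies where both terms exceed their values at `q` by less
    -- than `ε / 2`; the suprema are attained there.
    filter_upwards [tendsto_smallSets_iff.1 hlim _ h1, tendsto_smallSets_iff.1 hlim _ h2]
      with n hn1 hn2
    obtain ⟨q₁, hq₁, e₁, -⟩ := hHmax (K n) (hK n) ((hne n).mono Set.inter_subset_left) z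
    obtain ⟨q₂, hq₂, e₂, -⟩ := hwmax (K n) (hK n) s z (hne' n)
    rw [e₁, e₂]
    have h3 : v k s (h (q₁, z)) < v k s (h (q, z)) + ε / 2 := hn1 hq₁
    have h4 : W q₂ (s, z) < W q (s, z) + ε / 2 := hn2 hq₂.2 hq₂.1
    linarith

variable {Y : Type*} [TopologicalSpace Y] [T2Space Y] [SecondCountableTopology Y]
  [LocallyCompactSpace Y]

/-- Upper hemicontinuity confines the values near each point to one compact set, and finitely many
such neighbourhoods cover `F s`. For measurability the graph is cut into pieces to which
`MeasCompact.inter` applies. -/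
theorem MeasCompact.graph {F : S → Set Q} (hF : MeasCompact F) {X : Q → S → Set Y}
    (hXc : ∀ q s, IsCompact (X q s)) (hXu : ∀ s, UpperHemicontinuous (fun q => X q s))
    (hXm : GraphMeasurable X) :
    MeasCompact (fun s => {p : Q × Y | p.1 ∈ F s ∧ p.2 ∈ X p.1 s}) := by
  have hclosed : ∀ s, IsClosed {p : Q × Y | p.2 ∈ X p.1 s} := fun s => by
    refine IsSeqClosed.isClosed fun p a hp hpa => ?_
    exact UpperHemicontinuousAt.mem_of_tendsto (f := fun q => X q s) (hXu s a.1) (hXc _ _).isClosed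
      ((continuous_fst.tendsto a).comp hpa) (Frequently.of_forall hp)
      ((continuous_snd.tendsto a).comp hpa)
  refine ⟨fun s => ?_, fun C hC => ?_⟩
  · have h1 : ∀ q, ∃ K : Set Y, IsCompact K ∧ {q' | X q' s ⊆ K} ∈ 𝓝 q := fun q => by
      obtain ⟨K, hK, hsub⟩ := exists_compact_superset (hXc q s)
      refine ⟨K, hK, ?_⟩
      have h2 : K ∈ 𝓝ˢ (X q s) := subset_interior_iff_mem_nhdsSet.1 hsub
      filter_upwards [hXu s q K h2] with q' hq'
      exact subset_of_mem_nhdsSet hq'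
    choose K hK hKn using h1
    obtain ⟨t, -, ht⟩ := (hF.compact s).elim_nhds_subcover _ fun q _ => hKn q
    have hcomp : IsCompact (F s ×ˢ ⋃ q ∈ t, K q) :=
      (hF.compact s).prod (t.isCompact_biUnion fun q _ => hK q)
    refine hcomp.of_isClosed_subset ?_ ?_
    · exact ((hF.compact s).isClosed.preimage continuous_fst).inter (hclosed s)
    · rintro ⟨q, y⟩ ⟨hq, hy⟩
      refine ⟨hq, ?_⟩
      obtain ⟨q₀, hq₀, hsub⟩ := Set.mem_iUnion₂.1 (ht hq)
      exact Set.mem_biUnion hq₀ (hsub hy)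
  · rcases isEmpty_or_nonempty (Q × Y) with hQ | hQ
    · have : {s | (C ∩ {p : Q × Y | p.1 ∈ F s ∧ p.2 ∈ X p.1 s}).Nonempty} = ∅ := by
        ext s
        simp [Set.eq_empty_of_isEmpty]
      rw [this]
      exact .empty
    obtain ⟨B, hB⟩ := exists_isCellSystem (Q × Y)
    -- `F s × Y` need not be compact, so it is split along one level of cells; only countability and
    -- compactness of the cover matter, not its size.
    have hA : ∀ i, MeasCompact (fun s => {p : Q × Y | p ∈ B 0 i ∧ p.1 ∈ F s}) := by
      refine fun i => ⟨fun s => (hB.compact 0 i).inter_right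
        ((hF.compact s).isClosed.preimage continuous_fst), fun D hD => ?_⟩
      convert hF.hit (Prod.fst '' (D ∩ B 0 i))
        (((hB.compact 0 i).inter_left hD).image continuous_fst).isClosed using 4 with s
      constructor
      · rintro ⟨p, hpD, hpB, hpF⟩
        exact ⟨p.1, ⟨p, ⟨hpD, hpB⟩, rfl⟩, hpF⟩
      · rintro ⟨_, ⟨p, ⟨hpD, hpB⟩, rfl⟩, hpF⟩
        exact ⟨p, hpD, hpB, hpF⟩
    have hAX := fun i => (hA i).inter (H := fun s => {p : Q × Y | p.2 ∈ X p.1 s}) hclosed hXm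
    have key : {s | (C ∩ {p : Q × Y | p.1 ∈ F s ∧ p.2 ∈ X p.1 s}).Nonempty} = ⋃ i,
        {s | (C ∩ ({p : Q × Y | p ∈ B 0 i ∧ p.1 ∈ F s} ∩
          {p : Q × Y | p.2 ∈ X p.1 s})).Nonempty} := by
      ext s
      simp only [Set.mem_iUnion, Set.mem_ofPred_eq]
      constructor
      · rintro ⟨p, hpC, hpF, hpX⟩
        obtain ⟨i, hi⟩ := hB.cover 0 p
        exact ⟨i, p, hpC, ⟨hi, hpF⟩, hpX⟩
      · rintro ⟨i, p, hpC, ⟨-, hpF⟩, hpX⟩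
        exact ⟨p, hpC, hpF, hpX⟩
    rw [key]
    exact MeasurableSet.iUnion fun i => (hAX i).hit C hC

end

/-! ### Histories -/

namespace Hist

instance instT2Space (A : ℕ → Type) [∀ t, TopologicalSpace (A t)] [∀ t, T2Space (A t)] :
    ∀ t, T2Space (Hist A t)
  | 0 => inferInstanceAs (T2Space Unit)
  | t + 1 =>
    haveI := instT2Space A t
    inferInstanceAs (T2Space (Hist A t × A t))

instance instSecondCountableTopology (A : ℕ → Type) [∀ t, TopologicalSpace (A t)]
    [∀ t, SecondCountableTopology (A t)] : ∀ t, SecondCountableTopology (Hist A t)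
  | 0 => inferInstanceAs (SecondCountableTopology Unit)
  | t + 1 =>
    haveI := instSecondCountableTopology A t
    inferInstanceAs (SecondCountableTopology (Hist A t × A t))

instance instLocallyCompactSpace (A : ℕ → Type) [∀ t, TopologicalSpace (A t)]
    [∀ t, LocallyCompactSpace (A t)] : ∀ t, LocallyCompactSpace (Hist A t)
  | 0 => inferInstanceAs (LocallyCompactSpace Unit)
  | t + 1 =>
    haveI := instLocallyCompactSpace A t
    inferInstanceAs (LocallyCompactSpace (Hist A t × A t))

instance instBorelSpace (A : ℕ → Type) [∀ t, TopologicalSpace (A t)]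
    [∀ t, SecondCountableTopology (A t)] [∀ t, MeasurableSpace (A t)] [∀ t, BorelSpace (A t)] :
    ∀ t, BorelSpace (Hist A t)
  | 0 => inferInstanceAs (BorelSpace Unit)
  | t + 1 =>
    haveI := instBorelSpace A t
    inferInstanceAs (BorelSpace (Hist A t × A t))

instance instMeasurableSingletonClass (A : ℕ → Type) [∀ t, MeasurableSpace (A t)]
    [∀ t, MeasurableSingletonClass (A t)] : ∀ t, MeasurableSingletonClass (Hist A t)
  | 0 => inferInstanceAs (MeasurableSingletonClass Unit)
  | t + 1 =>
    haveI := instMeasurableSingletonClass A t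
    inferInstanceAs (MeasurableSingletonClass (Hist A t × A t))

variable {A : ℕ → Type} {t : ℕ}

theorem measurable_init [∀ t, MeasurableSpace (A t)] :
    Measurable (Hist.init : Hist A (t + 1) → Hist A t) :=
  measurable_fst (α := Hist A t) (β := A t)

theorem measurable_last [∀ t, MeasurableSpace (A t)] :
    Measurable (Hist.last : Hist A (t + 1) → A t) :=
  measurable_snd (α := Hist A t) (β := A t)

theorem continuous_last [∀ t, TopologicalSpace (A t)] :
    Continuous (Hist.last : Hist A (t + 1) → A t) :=
  continuous_snd (X := Hist A t) (Y := A t)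

theorem measurable_snoc_left [∀ t, MeasurableSpace (A t)] (a : Hist A t) :
    Measurable (fun b : A t => Hist.snoc a b) :=
  Hist.measurable_snoc.comp measurable_prodMk_left

end Hist

/-! ### Standing assumptions, value functions and tail bounds. -/

namespace Model

variable (M : Model)

section

variable (κ : ∀ t, Kernel (M.ObsHist t) (M.Ξ t))

/-- The standing assumptions on the rewards, the feasible sets and the stage ambiguity sets. -/
structure Regular (p : ℝ≥0∞) (b : ∀ t, M.ObsHist t → ℝ) : Prop where
  p_pos : 0 < p
  continuous_h : ∀ t < M.T, Continuous (M.h t)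
  compact_X : ∀ t < M.T, ∀ x ζ, IsCompact (M.X t x ζ)
  nonempty_X : ∀ t < M.T, ∀ x ζ, M.FeasHist t x ζ → (M.X t x ζ).Nonempty
  uhc_X : ∀ t < M.T, ∀ ζ, UpperHemicontinuous (fun x => M.X t x ζ)
  measurable_X : ∀ t < M.T, GraphMeasurable (M.X t)
  utility_U : ∀ t < M.T, ∀ ζ, ∀ u ∈ M.U t ζ, IsUtility u
  measurable_U : ∀ t < M.T, UtilMeasurable p (M.U t)
  measurable_b : ∀ t < M.T, Measurable (b t)
  bound_U : ∀ t < M.T, ∀ ζ, ∀ u ∈ M.U t ζ, ∀ y, |u y| ≤ b t ζ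
  integrable_b : ∀ t k, t + k < M.T → ∀ ζ : M.ObsHist t, Integrable (b (t + k)) (M.condLaw κ ζ k)

/-- The worst-case conditional expected utility of the stage `t` for the decision `y`. -/
def reward (t : ℕ) (y : M.Dec t) (ζ : M.ObsHist t) : ℝ :=
  ⨅ u : M.U t ζ, ∫ z, u.1 (M.h t (y, (z : EuclideanSpace ℝ (Fin (M.d t))))) ∂κ t ζ

/-- The feasible extensions by one decision of the feasible decision histories. -/
def feasNext (t : ℕ) (ζ : M.ObsHist t) : Set (M.DecHist (t + 1)) :=
  {q | M.FeasHist t q.init ζ ∧ q.last ∈ M.X t q.init ζ}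

/-- The value function with `k` remaining stages, equal to `0` at infeasible histories. -/
def valueAux : ∀ (_k t : ℕ), M.DecHist t → M.ObsHist t → ℝ
  | 0, _, _, _ => 0
  | k + 1, t, x, ζ => sSup (M.stageObjective κ t (valueAux k (t + 1)) x ζ ''
      {y | M.FeasHist t x ζ ∧ y ∈ M.X t x ζ})

/-- The value function of stage `t`. -/
def value (t : ℕ) : M.DecHist t → M.ObsHist t → ℝ :=
  M.valueAux κ (M.T - t) t

/-- The conditional expectation of the sum of the bounds of `k` stages from stage `t` on. -/
def tailBoundAux (b : ∀ t, M.ObsHist t → ℝ) : ∀ (_k t : ℕ), M.ObsHist t → ℝ≥0∞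
  | 0, _, _ => 0
  | k + 1, t, ζ => ENNReal.ofReal (b t ζ) +
      ∫⁻ z, tailBoundAux b k (t + 1) (Hist.snoc ζ z) ∂κ t ζ

/-- The conditional expectation of the sum of the bounds of the stages from `t` on. -/
def tailBound (b : ∀ t, M.ObsHist t → ℝ) (t : ℕ) : M.ObsHist t → ℝ≥0∞ :=
  M.tailBoundAux κ b (M.T - t) t

theorem value_eq_zero {t : ℕ} (ht : M.T ≤ t) (x : M.DecHist t) (ζ : M.ObsHist t) :
    M.value κ t x ζ = 0 := by
  rw [value, Nat.sub_eq_zero_of_le ht, valueAux]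

theorem value_eq {t : ℕ} (ht : t < M.T) (x : M.DecHist t) (ζ : M.ObsHist t) :
    M.value κ t x ζ = sSup (M.stageObjective κ t (M.value κ (t + 1)) x ζ ''
      {y | M.FeasHist t x ζ ∧ y ∈ M.X t x ζ}) := by
  obtain ⟨k, hk⟩ : ∃ k, M.T - t = k + 1 := ⟨M.T - t - 1, by omega⟩
  have hk' : M.T - (t + 1) = k := by omega
  have : M.value κ (t + 1) = M.valueAux κ k (t + 1) := by rw [value, hk']
  rw [this, value, hk, valueAux]

variable (b : ∀ t, M.ObsHist t → ℝ)

theorem tailBound_eq_zero {t : ℕ} (ht : M.T ≤ t) (ζ : M.ObsHist t) :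
    M.tailBound κ b t ζ = 0 := by
  rw [tailBound, Nat.sub_eq_zero_of_le ht, tailBoundAux]

theorem tailBound_eq {t : ℕ} (ht : t < M.T) (ζ : M.ObsHist t) :
    M.tailBound κ b t ζ = ENNReal.ofReal (b t ζ) +
      ∫⁻ z, M.tailBound κ b (t + 1) (Hist.snoc ζ z) ∂κ t ζ := by
  obtain ⟨k, hk⟩ : ∃ k, M.T - t = k + 1 := ⟨M.T - t - 1, by omega⟩
  have hk' : M.T - (t + 1) = k := by omega
  have : M.tailBound κ b (t + 1) = M.tailBoundAux κ b k (t + 1) := by rw [tailBound, hk']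
  rw [this, tailBound, hk, tailBoundAux]

/-! ### The conditional laws -/

variable [∀ t, IsMarkovKernel (κ t)]

instance instIsProbabilityMeasureCondLaw {t : ℕ} (ζ : M.ObsHist t) :
    ∀ k, IsProbabilityMeasure (M.condLaw κ ζ k)
  | 0 => Measure.dirac.isProbabilityMeasure
  | k + 1 =>
    haveI := instIsProbabilityMeasureCondLaw ζ k
    Measure.isProbabilityMeasure_map Hist.measurable_snoc.aemeasurable

variable {κ}

theorem lintegral_condLaw_succ {t : ℕ} (ζ : M.ObsHist t) (k : ℕ)
    {f : M.ObsHist (t + k + 1) → ℝ≥0∞} (hf : Measurable f) :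
    ∫⁻ ζ', f ζ' ∂M.condLaw κ ζ (k + 1) =
      ∫⁻ ζ', ∫⁻ z, f (Hist.snoc ζ' z) ∂κ (t + k) ζ' ∂M.condLaw κ ζ k := by
  rw [condLaw]
  refine (lintegral_map hf Hist.measurable_snoc).trans ?_
  exact Measure.lintegral_compProd (hf.comp Hist.measurable_snoc)

theorem integral_condLaw_succ {t : ℕ} (ζ : M.ObsHist t) (k : ℕ)
    {f : M.ObsHist (t + k + 1) → ℝ} (hf : Measurable f)
    (hfi : Integrable f (M.condLaw κ ζ (k + 1))) :
    ∫ ζ', f ζ' ∂M.condLaw κ ζ (k + 1) =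
      ∫ ζ', ∫ z, f (Hist.snoc ζ' z) ∂κ (t + k) ζ' ∂M.condLaw κ ζ k := by
  rw [condLaw] at hfi ⊢
  refine (integral_map Hist.measurable_snoc.aemeasurable hf.aestronglyMeasurable).trans ?_
  refine Measure.integral_compProd ?_
  exact (integrable_map_measure hf.aestronglyMeasurable Hist.measurable_snoc.aemeasurable).1 hfi

theorem map_init_condLaw_succ {t : ℕ} (ζ : M.ObsHist t) (k : ℕ) :
    (M.condLaw κ ζ (k + 1)).map Hist.init = M.condLaw κ ζ k := by
  rw [condLaw]
  refine (Measure.map_map Hist.measurable_init Hist.measurable_snoc).trans ?_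
  exact Measure.fst_compProd (M.condLaw κ ζ k) (κ (t + k))

theorem ae_condLaw_succ_of_init {t : ℕ} (ζ : M.ObsHist t) (k : ℕ) {q : M.ObsHist (t + k) → Prop}
    (h : ∀ᵐ ζ' ∂M.condLaw κ ζ k, q ζ') :
    ∀ᵐ ζ' ∂M.condLaw κ ζ (k + 1), q (Hist.init ζ') := by
  rw [← map_init_condLaw_succ] at h
  exact ae_of_ae_map Hist.measurable_init.aemeasurable h

variable {M b} {p : ℝ≥0∞}

/-! ### Bounds -/

namespace Regular

theorem measurable_tailBound (H : M.Regular κ p b) :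
    ∀ k t, t + k = M.T → Measurable (M.tailBound κ b t)
  | 0, t, ht => by
    have : M.tailBound κ b t = fun _ => 0 := funext fun ζ => M.tailBound_eq_zero κ b (by omega) ζ
    rw [this]
    exact measurable_const
  | k + 1, t, ht => by
    have : M.tailBound κ b t = _ := funext fun ζ => M.tailBound_eq κ b (by omega) ζ
    rw [this]
    refine (H.measurable_b t (by omega)).ennreal_ofReal.add ?_
    exact Measurable.lintegral_kernel_prod_right'
      ((measurable_tailBound H k (t + 1) (by omega)).comp Hist.measurable_snoc)

/-- Descending induction from the last stage: integrating the recursion adds the integral of `b (t +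
k)` to the integral one stage later. The case `k = 0`, a Dirac mass, gives finiteness at every
history and not merely almost every one. -/
theorem lintegral_tailBound_lt_top (H : M.Regular κ p b) {t : ℕ} (ζ : M.ObsHist t) :
    ∀ j k, t + k + j = M.T → ∫⁻ ζ', M.tailBound κ b (t + k) ζ' ∂M.condLaw κ ζ k < ∞
  | 0, k, h => by
    simp_rw [M.tailBound_eq_zero κ b (t := t + k) (by omega)]
    simp
  | j + 1, k, h => by
    have IH := lintegral_tailBound_lt_top H ζ j (k + 1) (by omega)
    have hm : Measurable (M.tailBound κ b (t + k + 1)) := H.measurable_tailBound j _ (by omega)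
    replace IH := (M.lintegral_condLaw_succ ζ k hm).symm.trans_lt IH
    simp_rw [M.tailBound_eq κ b (t := t + k) (by omega)]
    rw [lintegral_add_left (H.measurable_b (t + k) (by omega)).ennreal_ofReal]
    exact ENNReal.add_lt_top.2 ⟨(H.integrable_b t k (by omega) ζ).lintegral_lt_top, IH⟩

theorem integrable_tailBound (H : M.Regular κ p b) {t : ℕ} (ζ : M.ObsHist t) {k : ℕ}
    (hk : t + k ≤ M.T) :
    Integrable (fun ζ' => (M.tailBound κ b (t + k) ζ').toReal) (M.condLaw κ ζ k) :=
  integrable_toReal_of_lintegral_ne_top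
    (H.measurable_tailBound (M.T - (t + k)) _ (by omega)).aemeasurable
    (H.lintegral_tailBound_lt_top ζ (M.T - (t + k)) k (by omega)).ne

theorem tailBound_lt_top (H : M.Regular κ p b) {t : ℕ} (ht : t ≤ M.T) (ζ : M.ObsHist t) :
    M.tailBound κ b t ζ < ∞ := by
  have := H.lintegral_tailBound_lt_top ζ (M.T - t) 0 (by omega)
  rwa [condLaw, lintegral_dirac] at this

theorem lintegral_tailBound_snoc_ne_top (H : M.Regular κ p b) {t : ℕ} (ht : t < M.T)
    (ζ : M.ObsHist t) : ∫⁻ z, M.tailBound κ b (t + 1) (Hist.snoc ζ z) ∂κ t ζ ≠ ∞ := by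
  have := H.tailBound_lt_top ht.le ζ
  rw [M.tailBound_eq κ b ht] at this
  exact (ENNReal.add_lt_top.1 this).2.ne

theorem measurable_tailBound_snoc (H : M.Regular κ p b) {t : ℕ} (ht : t < M.T) (ζ : M.ObsHist t) :
    Measurable (fun z => M.tailBound κ b (t + 1) (Hist.snoc ζ z)) :=
  (H.measurable_tailBound (M.T - (t + 1)) _ (by omega)).comp (Hist.measurable_snoc_left ζ)

theorem integrable_tailBound_snoc (H : M.Regular κ p b) {t : ℕ} (ht : t < M.T) (ζ : M.ObsHist t) :
    Integrable (fun z => (M.tailBound κ b (t + 1) (Hist.snoc ζ z)).toReal) (κ t ζ) :=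
  integrable_toReal_of_lintegral_ne_top (H.measurable_tailBound_snoc ht ζ).aemeasurable
    (H.lintegral_tailBound_snoc_ne_top ht ζ)

theorem nonempty_U (H : M.Regular κ p b) {t : ℕ} (ht : t < M.T) (ζ : M.ObsHist t) :
    Nonempty (M.U t ζ) := by
  obtain ⟨v, -, hv, -⟩ := H.measurable_U t ht
  exact ⟨⟨v 0 ζ, hv 0 ζ⟩⟩

theorem b_nonneg (H : M.Regular κ p b) {t : ℕ} (ht : t < M.T) (ζ : M.ObsHist t) : 0 ≤ b t ζ := by
  obtain ⟨u, hu⟩ := H.nonempty_U ht ζ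
  exact (abs_nonneg _).trans (H.bound_U t ht ζ u hu 0)

theorem toReal_tailBound (H : M.Regular κ p b) {t : ℕ} (ht : t < M.T) (ζ : M.ObsHist t) :
    (M.tailBound κ b t ζ).toReal = b t ζ +
      ∫ z, (M.tailBound κ b (t + 1) (Hist.snoc ζ z)).toReal ∂κ t ζ := by
  rw [M.tailBound_eq κ b ht, ENNReal.toReal_add ENNReal.ofReal_ne_top
    (H.lintegral_tailBound_snoc_ne_top ht ζ), ENNReal.toReal_ofReal (H.b_nonneg ht ζ),
    integral_toReal (H.measurable_tailBound_snoc ht ζ).aemeasurable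
      (Eventually.of_forall fun z => H.tailBound_lt_top ht _)]

/-! ### The worst-case reward of a stage -/

theorem measurable_h (H : M.Regular κ p b) {t : ℕ} (ht : t < M.T) :
    Measurable (fun q : M.Dec t × M.Ξ t =>
      M.h t (q.1, (q.2 : EuclideanSpace ℝ (Fin (M.d t))))) := by
  have := H.continuous_h t ht
  have h2 : Continuous (fun q : M.Dec t × M.Ξ t =>
      M.h t (q.1, (q.2 : EuclideanSpace ℝ (Fin (M.d t))))) := by fun_prop
  exact h2.measurable

theorem measurable_h_right (H : M.Regular κ p b) {t : ℕ} (ht : t < M.T) (y : M.Dec t) :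
    Measurable (fun z : M.Ξ t => M.h t (y, (z : EuclideanSpace ℝ (Fin (M.d t))))) :=
  (H.measurable_h ht).comp measurable_prodMk_left

theorem integrable_utility (H : M.Regular κ p b) {t : ℕ} (ht : t < M.T) (ζ : M.ObsHist t)
    (y : M.Dec t) {u : ℝ → ℝ} (hu : u ∈ M.U t ζ) :
    Integrable (fun z : M.Ξ t => u (M.h t (y, (z : EuclideanSpace ℝ (Fin (M.d t)))))) (κ t ζ) :=
  (integrable_const (b t ζ)).mono'
    ((H.utility_U t ht ζ u hu).measurable.comp (H.measurable_h_right ht y)).aestronglyMeasurable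
    (Eventually.of_forall fun _ => H.bound_U t ht ζ u hu _)

theorem abs_integral_utility_le (H : M.Regular κ p b) {t : ℕ} (ht : t < M.T) (ζ : M.ObsHist t)
    (y : M.Dec t) {u : ℝ → ℝ} (hu : u ∈ M.U t ζ) :
    |∫ z : M.Ξ t, u (M.h t (y, (z : EuclideanSpace ℝ (Fin (M.d t))))) ∂κ t ζ| ≤ b t ζ := by
  have := norm_integral_le_of_norm_le_const (μ := κ t ζ)
    (f := fun z : M.Ξ t => u (M.h t (y, (z : EuclideanSpace ℝ (Fin (M.d t)))))) (C := b t ζ)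
    (Eventually.of_forall fun z => H.bound_U t ht ζ u hu _)
  rwa [probReal_univ, mul_one] at this

theorem bddBelow_reward (H : M.Regular κ p b) {t : ℕ} (ht : t < M.T) (ζ : M.ObsHist t)
    (y : M.Dec t) : BddBelow (Set.range fun u : M.U t ζ =>
      ∫ z, u.1 (M.h t (y, (z : EuclideanSpace ℝ (Fin (M.d t))))) ∂κ t ζ) :=
  ⟨-b t ζ, by rintro _ ⟨u, rfl⟩; exact (abs_le.1 (H.abs_integral_utility_le ht ζ y u.2)).1⟩

theorem reward_le (H : M.Regular κ p b) {t : ℕ} (ht : t < M.T) (ζ : M.ObsHist t)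
    (y : M.Dec t) {u : ℝ → ℝ} (hu : u ∈ M.U t ζ) : M.reward κ t y ζ ≤
      ∫ z : M.Ξ t, u (M.h t (y, (z : EuclideanSpace ℝ (Fin (M.d t))))) ∂κ t ζ :=
  ciInf_le (H.bddBelow_reward ht ζ y) ⟨u, hu⟩

theorem abs_reward_le (H : M.Regular κ p b) {t : ℕ} (ht : t < M.T) (ζ : M.ObsHist t)
    (y : M.Dec t) : |M.reward κ t y ζ| ≤ b t ζ := by
  have := H.nonempty_U ht ζ
  obtain ⟨u, hu⟩ := H.nonempty_U ht ζ
  refine abs_le.2 ⟨le_ciInf fun u => (abs_le.1 (H.abs_integral_utility_le ht ζ y u.2)).1, ?_⟩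
  exact (H.reward_le ht ζ y hu).trans (abs_le.1 (H.abs_integral_utility_le ht ζ y hu)).2

/-- The cost-to-go is the same for all utilities, so its integral is a constant that leaves the
infimum. -/
theorem stageObjective_eq (H : M.Regular κ p b) {t : ℕ} (ht : t < M.T)
    (W : M.DecHist (t + 1) → M.ObsHist (t + 1) → ℝ) (x : M.DecHist t) (ζ : M.ObsHist t)
    (y : M.Dec t) (hW : Integrable (fun z => W (Hist.snoc x y) (Hist.snoc ζ z)) (κ t ζ)) :
    M.stageObjective κ t W x ζ y = M.reward κ t y ζ +
      ∫ z, W (Hist.snoc x y) (Hist.snoc ζ z) ∂κ t ζ := by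
  have := H.nonempty_U ht ζ
  rw [reward, ciInf_add (H.bddBelow_reward ht ζ y), stageObjective]
  exact iInf_congr fun u => integral_add (H.integrable_utility ht ζ y u.2) hW

/-- A sequence of measurable selections over which the worst-case reward can be computed. -/
theorem exists_dense (H : M.Regular κ p b) {t : ℕ} (ht : t < M.T) :
    ∃ v : ℕ → M.ObsHist t → ℝ → ℝ, (∀ k, Measurable (fun q : M.ObsHist t × ℝ => v k q.1 q.2)) ∧
      (∀ k ζ, v k ζ ∈ M.U t ζ) ∧ ∀ y ζ, M.reward κ t y ζ =
        ⨅ k, ∫ z, v k ζ (M.h t (y, (z : EuclideanSpace ℝ (Fin (M.d t))))) ∂κ t ζ := by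
  obtain ⟨v, hvm, hvU, hd⟩ := H.measurable_U t ht
  exact ⟨v, hvm, hvU, fun y ζ => iInf_integral_eq_iInf_nat H.p_pos (H.utility_U t ht ζ)
    (H.bound_U t ht ζ) (fun k => hvU k ζ) (hd ζ) (H.measurable_h_right ht y)⟩

theorem measurable_integral_utility (H : M.Regular κ p b) {t : ℕ} (ht : t < M.T)
    {u : M.ObsHist t → ℝ → ℝ} (hu : Measurable (fun q : M.ObsHist t × ℝ => u q.1 q.2)) :
    Measurable (fun q : M.Dec t × M.ObsHist t =>
      ∫ z, u q.2 (M.h t (q.1, (z : EuclideanSpace ℝ (Fin (M.d t))))) ∂κ t q.2) := by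
  have h1 : StronglyMeasurable (fun q : (M.Dec t × M.ObsHist t) × M.Ξ t =>
      u q.1.2 (M.h t (q.1.1, (q.2 : EuclideanSpace ℝ (Fin (M.d t)))))) :=
    (hu.comp ((measurable_snd.comp measurable_fst).prodMk ((H.measurable_h ht).comp
      ((measurable_fst.comp measurable_fst).prodMk measurable_snd)))).stronglyMeasurable
  let κ' : Kernel (M.Dec t × M.ObsHist t) (M.Ξ t) := (κ t).comap Prod.snd measurable_snd
  exact (h1.integral_kernel_prod_right' (κ := κ')).measurable

theorem measurable_reward (H : M.Regular κ p b) {t : ℕ} (ht : t < M.T) :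
    Measurable (fun q : M.Dec t × M.ObsHist t => M.reward κ t q.1 q.2) := by
  obtain ⟨v, hvm, -, hv⟩ := H.exists_dense ht
  simp_rw [hv]
  exact Measurable.iInf fun k => H.measurable_integral_utility ht (hvm k)

/-! ### Feasible decision histories -/

theorem measCompact_feasNext_of (H : M.Regular κ p b) {t : ℕ} (ht : t < M.T)
    (hF : MeasCompact (fun ζ : M.ObsHist t => {x | M.FeasHist t x ζ})) :
    MeasCompact (M.feasNext t) :=
  hF.graph (H.compact_X t ht) (H.uhc_X t ht) (H.measurable_X t ht)

/-- By induction: the feasible histories of the next stage form the graph of `M.X t` over the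
current ones. They do not depend on the newest observation, whence the composition with `Hist.init`.
-/
theorem measCompact_feasHist (H : M.Regular κ p b) :
    ∀ t, t ≤ M.T → MeasCompact (fun ζ : M.ObsHist t => {x | M.FeasHist t x ζ})
  | 0, _ => by
    refine ⟨fun ζ => ?_, fun C _ =>
      (Set.toFinite (α := Unit) _).measurableSet⟩
    exact (Set.toFinite (α := Unit) _).isCompact
  | t + 1, ht => (H.measCompact_feasNext_of ht (measCompact_feasHist H t (by omega))).comp
      Hist.measurable_init

theorem measCompact_feasNext (H : M.Regular κ p b) {t : ℕ} (ht : t < M.T) :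
    MeasCompact (M.feasNext t) :=
  H.measCompact_feasNext_of ht (H.measCompact_feasHist t ht.le)

end Regular

end

end Model

namespace Model

variable {M : Model} {κ : ∀ t, Kernel (M.ObsHist t) (M.Ξ t)} [∀ t, IsMarkovKernel (κ t)]
  {p : ℝ≥0∞} {b : ∀ t, M.ObsHist t → ℝ}

/-! ### Regularity of the value functions -/

variable (M) in
/-- A function of the histories before stage `t` that is jointly measurable, bounded by `β`, and
has measurable compact superlevel sets on the feasible decision histories. -/
structure RegularAt (t : ℕ) (W : M.DecHist t → M.ObsHist t → ℝ) (β : M.ObsHist t → ℝ) : Prop where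
  measurable : Measurable (fun q : M.DecHist t × M.ObsHist t => W q.1 q.2)
  abs_le : ∀ x ζ, |W x ζ| ≤ β ζ
  normal : NormalOn (fun ζ : M.ObsHist t => {x | M.FeasHist t x ζ}) W

namespace Regular

section

variable {t : ℕ} {W : M.DecHist (t + 1) → M.ObsHist (t + 1) → ℝ} {β : M.ObsHist (t + 1) → ℝ}

theorem integrable_snoc (hW : M.RegularAt (t + 1) W β) {ζ : M.ObsHist t}
    (hβ : Integrable (fun z => β (Hist.snoc ζ z)) (κ t ζ)) (q : M.DecHist (t + 1)) :
    Integrable (fun z => W q (Hist.snoc ζ z)) (κ t ζ) :=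
  hβ.mono' (hW.measurable.comp
    (measurable_const.prodMk (Hist.measurable_snoc_left ζ))).aestronglyMeasurable
    (Eventually.of_forall fun _ => hW.abs_le _ _)

/-- The one-stage objective, as a function of the extended decision history. -/
theorem normalOn_stageObjective (H : M.Regular κ p b) (ht : t < M.T)
    (hW : M.RegularAt (t + 1) W β)
    (hβ : ∀ ζ : M.ObsHist t, Integrable (fun z => β (Hist.snoc ζ z)) (κ t ζ)) :
    NormalOn (M.feasNext t)
      (fun q ζ => M.stageObjective κ t W (Hist.init q) ζ (Hist.last q)) := by
  obtain ⟨v, hvm, hvU, hd⟩ := H.exists_dense ht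
  have hcont : Continuous (fun a : M.DecHist (t + 1) × M.Ξ t =>
      M.h t (a.1.last, (a.2 : EuclideanSpace ℝ (Fin (M.d t))))) := by
    have h1 := H.continuous_h t ht
    have h2 : Continuous (fun q : M.DecHist (t + 1) => q.last) := Hist.continuous_last
    fun_prop
  have key := NormalOn.iInf_integral_add (κ := κ t) hcont hvm
    (fun k ζ => H.utility_U t ht ζ _ (hvU k ζ)) (fun k ζ => H.bound_U t ht ζ _ (hvU k ζ))
    (H.measCompact_feasNext ht) (W := fun q a => W q (Hist.snoc a.1 a.2))
    (β := fun a => β (Hist.snoc a.1 a.2)) (hW.normal.comp Hist.measurable_snoc)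
    (fun q ζ => hW.measurable.comp (measurable_const.prodMk (Hist.measurable_snoc_left ζ)))
    (fun q a => hW.abs_le _ _) hβ
  convert key using 3 with q ζ
  have hi := integrable_snoc hW (hβ ζ) q
  rw [H.stageObjective_eq ht W q.init ζ q.last hi, hd]
  rw [ciInf_add ⟨-b t ζ, by
    rintro _ ⟨k, rfl⟩
    exact (abs_le.1 (H.abs_integral_utility_le ht ζ q.last (hvU k ζ))).1⟩]
  exact iInf_congr fun k => (integral_add (H.integrable_utility ht ζ q.last (hvU k ζ)) hi).symm

/-- The feasible decisions depend measurably on the pair of histories. -/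
theorem measCompact_section (H : M.Regular κ p b) (ht : t < M.T) :
    MeasCompact (fun a : M.DecHist t × M.ObsHist t =>
      {y | M.FeasHist t a.1 a.2 ∧ y ∈ M.X t a.1 a.2}) :=
  MeasCompact.prodSection (Q := M.DecHist t) (Y := M.Dec t) (H.measCompact_feasNext ht)

theorem normalOn_section (H : M.Regular κ p b) (ht : t < M.T)
    (hW : M.RegularAt (t + 1) W β)
    (hβ : ∀ ζ : M.ObsHist t, Integrable (fun z => β (Hist.snoc ζ z)) (κ t ζ)) :
    NormalOn (fun a : M.DecHist t × M.ObsHist t =>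
      {y | M.FeasHist t a.1 a.2 ∧ y ∈ M.X t a.1 a.2})
      (fun y a => M.stageObjective κ t W a.1 a.2 y) :=
  NormalOn.prodSection (Q := M.DecHist t) (Y := M.Dec t) (H.normalOn_stageObjective ht hW hβ)

theorem exists_max_stageObjective (H : M.Regular κ p b) (ht : t < M.T)
    (hW : M.RegularAt (t + 1) W β)
    (hβ : ∀ ζ : M.ObsHist t, Integrable (fun z => β (Hist.snoc ζ z)) (κ t ζ))
    {x : M.DecHist t} {ζ : M.ObsHist t} (hx : M.FeasHist t x ζ) :
    ∃ y ∈ M.X t x ζ, IsGreatest (M.stageObjective κ t W x ζ '' M.X t x ζ)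
      (M.stageObjective κ t W x ζ y) ∧
      sSup (M.stageObjective κ t W x ζ '' {y | M.FeasHist t x ζ ∧ y ∈ M.X t x ζ}) =
        M.stageObjective κ t W x ζ y := by
  obtain ⟨y₀, hy₀⟩ := H.nonempty_X t ht x ζ hx
  obtain ⟨y, hy, hmax⟩ := (H.normalOn_section ht hW hβ).exists_max (H.measCompact_section ht)
    (s := (x, ζ)) ⟨y₀, hx, hy₀⟩
  have hset : {y | M.FeasHist t x ζ ∧ y ∈ M.X t x ζ} = M.X t x ζ := by
    ext y
    simp [hx]
  have hgr : IsGreatest (M.stageObjective κ t W x ζ '' M.X t x ζ)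
      (M.stageObjective κ t W x ζ y) :=
    ⟨⟨y, hy.2, rfl⟩, by rintro _ ⟨y', hy', rfl⟩; exact hmax y' ⟨hx, hy'⟩⟩
  exact ⟨y, hy.2, hgr, by rw [hset, hgr.csSup_eq]⟩

/-- The step of the backward induction. A superlevel set of the maximum is the projection of the
same superlevel set of the objective on extended histories, because the maximum is attained;
continuous images preserve `MeasCompact`. -/
theorem regularAt_max (H : M.Regular κ p b) (ht : t < M.T)
    (hW : M.RegularAt (t + 1) W β)
    (hβ : ∀ ζ : M.ObsHist t, Integrable (fun z => β (Hist.snoc ζ z)) (κ t ζ)) :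
    M.RegularAt t (fun x ζ => sSup (M.stageObjective κ t W x ζ ''
      {y | M.FeasHist t x ζ ∧ y ∈ M.X t x ζ}))
      (fun ζ => b t ζ + ∫ z, β (Hist.snoc ζ z) ∂κ t ζ) where
  measurable := (H.normalOn_section ht hW hβ).measurable_sSup (H.measCompact_section ht)
  abs_le x ζ := by
    -- The decision `0` serves only to form some extended history, at which the bound on `W` shows
    -- that `β` is nonnegative.
    have hint : |∫ z, β (Hist.snoc ζ z) ∂κ t ζ| ≤ ∫ z, β (Hist.snoc ζ z) ∂κ t ζ :=
      (abs_of_nonneg (integral_nonneg fun z => (abs_nonneg _).trans (hW.abs_le (Hist.snoc x 0) _))).le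
    by_cases hx : M.FeasHist t x ζ
    · obtain ⟨y, -, -, hy⟩ := H.exists_max_stageObjective ht hW hβ hx
      have hi := integrable_snoc hW (hβ ζ) (Hist.snoc x y)
      rw [hy, H.stageObjective_eq ht W x ζ y hi]
      refine (abs_add_le _ _).trans (add_le_add (H.abs_reward_le ht ζ y) ?_)
      exact norm_integral_le_of_norm_le (f := fun z => W (Hist.snoc x y) (Hist.snoc ζ z)) (hβ ζ) (Eventually.of_forall fun z => hW.abs_le _ _)
    · have h0 := (abs_nonneg _).trans hint
      have h1 := H.b_nonneg ht ζ
      have : {y | M.FeasHist t x ζ ∧ y ∈ M.X t x ζ} = ∅ := by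
        ext y
        simp [hx]
      rw [this, Set.image_empty, Real.sSup_empty, abs_zero]
      exact add_nonneg h1 h0
  normal a := by
    have hfst : Continuous (Hist.init : M.DecHist (t + 1) → M.DecHist t) :=
      continuous_fst (X := M.DecHist t) (Y := M.Dec t)
    have key := (H.normalOn_stageObjective ht hW hβ a).image hfst
    convert key using 2 with ζ
    ext x
    constructor
    · rintro ⟨hx, hax⟩
      obtain ⟨y, hyX, -, hy⟩ := H.exists_max_stageObjective ht hW hβ hx
      exact ⟨Hist.snoc x y, ⟨⟨hx, hyX⟩, hax.trans hy.le⟩, rfl⟩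
    · rintro ⟨q, ⟨⟨hx, hyX⟩, ha⟩, rfl⟩
      obtain ⟨y, -, hgr, hy⟩ := H.exists_max_stageObjective ht hW hβ hx
      exact ⟨hx, ha.trans ((hgr.2 ⟨_, hyX, rfl⟩).trans hy.ge)⟩

end

theorem regularAt_value (H : M.Regular κ p b) :
    ∀ k t, t + k = M.T →
      M.RegularAt t (M.value κ t) (fun ζ => (M.tailBound κ b t ζ).toReal)
  | 0, t, h => by
    have h0 : M.value κ t = fun _ _ => 0 :=
      funext fun x => funext fun ζ => M.value_eq_zero κ (by omega) x ζ
    rw [h0]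
    refine ⟨measurable_const, fun x ζ => by simp, fun a => ?_⟩
    -- For the zero function a superlevel set is the whole feasible set or empty.
    by_cases ha : a ≤ 0
    · simpa [ha] using H.measCompact_feasHist t (by omega)
    · simp only [ha, and_false]
      exact ⟨fun _ => isCompact_empty, fun C _ => by simp⟩
  | k + 1, t, h => by
    have ht : t < M.T := by omega
    have := H.regularAt_max ht (regularAt_value H k (t + 1) (by omega))
      (H.integrable_tailBound_snoc ht)
    convert this using 1
    · exact funext fun x => funext fun ζ => M.value_eq κ ht x ζ
    · exact funext fun ζ => H.toReal_tailBound ht ζ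

theorem regularAt (H : M.Regular κ p b) {t : ℕ} (ht : t ≤ M.T) :
    M.RegularAt t (M.value κ t) (fun ζ => (M.tailBound κ b t ζ).toReal) :=
  H.regularAt_value (M.T - t) t (by omega)

theorem integrable_value_snoc (H : M.Regular κ p b) {t : ℕ} (ht : t < M.T) (ζ : M.ObsHist t)
    (q : M.DecHist (t + 1)) :
    Integrable (fun z => M.value κ (t + 1) q (Hist.snoc ζ z)) (κ t ζ) :=
  integrable_snoc (H.regularAt (Nat.succ_le_of_lt ht)) (H.integrable_tailBound_snoc ht ζ) q

theorem isGreatest_value (H : M.Regular κ p b) {t : ℕ} (ht : t < M.T) {x : M.DecHist t}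
    {ζ : M.ObsHist t} (hx : M.FeasHist t x ζ) :
    IsGreatest (M.stageObjective κ t (M.value κ (t + 1)) x ζ '' M.X t x ζ) (M.value κ t x ζ) := by
  obtain ⟨y, -, hgr, hy⟩ := H.exists_max_stageObjective ht
    (H.regularAt (Nat.succ_le_of_lt ht)) (H.integrable_tailBound_snoc ht) hx
  rw [M.value_eq κ ht, hy]
  exact hgr

theorem satisfiesRecursion (H : M.Regular κ p b) : M.SatisfiesRecursion κ (M.value κ) where
  terminal := M.value_eq_zero κ le_rfl
  integrable _ ht _ ζ _ y _ _ hu :=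
    (H.integrable_utility ht ζ y hu).add (H.integrable_value_snoc ht ζ _)
  step _ ht _ _ hx := H.isGreatest_value ht hx

/-- A measurable selection of optimal decisions. -/
theorem exists_optimal_decision (H : M.Regular κ p b) {t : ℕ} (ht : t < M.T) :
    ∃ σ : M.DecHist t × M.ObsHist t → M.Dec t, Measurable σ ∧ ∀ x ζ, M.FeasHist t x ζ →
      σ (x, ζ) ∈ M.X t x ζ ∧
        M.stageObjective κ t (M.value κ (t + 1)) x ζ (σ (x, ζ)) = M.value κ t x ζ := by
  have hW := H.regularAt (Nat.succ_le_of_lt ht)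
  -- With the value as threshold, the superlevel set at a feasible history is the set of optimal
  -- decisions.
  have hA := (H.normalOn_section ht hW (H.integrable_tailBound_snoc ht)).threshold
    (H.measCompact_section ht) (H.regularAt ht.le).measurable
  obtain ⟨σ, hσ, hσA⟩ := hA.exists_selection
  refine ⟨σ, hσ, fun x ζ hx => ?_⟩
  have hgr := H.isGreatest_value ht hx
  obtain ⟨y, hyX, hy⟩ := hgr.1
  obtain ⟨⟨-, h1⟩, h2⟩ := hσA (x, ζ) ⟨y, ⟨hx, hyX⟩, hy.ge⟩
  exact ⟨h1, le_antisymm (hgr.2 ⟨_, h1, rfl⟩) h2⟩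

end Regular

/-! ### The worst-case expected utility of a policy -/

namespace Regular

theorem measurable_reward_policy (H : M.Regular κ p b) {π : M.Policy} (hπ : M.Implementable π)
    {s : ℕ} (hs : s < M.T) : Measurable (fun ζ => M.reward κ s (π s ζ) ζ) :=
  (H.measurable_reward hs).comp ((hπ s hs).prodMk measurable_id)

theorem integrable_reward_policy (H : M.Regular κ p b) {π : M.Policy} (hπ : M.Implementable π)
    {t k : ℕ} (hk : t + k < M.T) (ζ : M.ObsHist t) :
    Integrable (fun ζ' => M.reward κ (t + k) (π (t + k) ζ') ζ') (M.condLaw κ ζ k) :=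
  (H.integrable_b t k hk ζ).mono' (H.measurable_reward_policy hπ hk).aestronglyMeasurable
    (Eventually.of_forall fun ζ' => H.abs_reward_le hk ζ' _)

/-- The conditional expected utility of the stage `s` under a policy. -/
theorem measurable_integral_policy (H : M.Regular κ p b) {π : M.Policy} (hπ : M.Implementable π)
    {u : M.UtilSeq} (hu : u ∈ M.ambiguitySet) {s : ℕ} (hs : s < M.T) :
    Measurable (fun ζ => ∫ z, u s ζ (M.h s (π s ζ, (z : EuclideanSpace ℝ (Fin (M.d s))))) ∂κ s ζ) :=
  (H.measurable_integral_utility hs (hu s hs).1).comp ((hπ s hs).prodMk measurable_id)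

theorem integrable_integral_policy (H : M.Regular κ p b) {π : M.Policy} (hπ : M.Implementable π)
    {u : M.UtilSeq} (hu : u ∈ M.ambiguitySet) {t k : ℕ} (hk : t + k < M.T) (ζ : M.ObsHist t) :
    Integrable (fun ζ' => ∫ z, u (t + k) ζ' (M.h (t + k) (π (t + k) ζ',
      (z : EuclideanSpace ℝ (Fin (M.d (t + k)))))) ∂κ (t + k) ζ') (M.condLaw κ ζ k) :=
  (H.integrable_b t k hk ζ).mono' (H.measurable_integral_policy hπ hu hk).aestronglyMeasurable
    (Eventually.of_forall fun ζ' => H.abs_integral_utility_le hk ζ' _ ((hu _ hk).2 ζ'))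

/-- The expected total utility is the sum of the expected conditional expected utilities. -/
theorem integral_totalUtility (H : M.Regular κ p b) {π : M.Policy} (hπ : M.Implementable π)
    {u : M.UtilSeq} (hu : u ∈ M.ambiguitySet) {t : ℕ} (ζ : M.ObsHist t) :
    ∀ K, t + K ≤ M.T → Measurable (M.totalUtility u π t K) ∧
      Integrable (M.totalUtility u π t K) (M.condLaw κ ζ K) ∧
      ∫ ζ', M.totalUtility u π t K ζ' ∂M.condLaw κ ζ K =
        ∑ k ∈ Finset.range K, ∫ ζ', ∫ z, u (t + k) ζ' (M.h (t + k) (π (t + k) ζ',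
          (z : EuclideanSpace ℝ (Fin (M.d (t + k)))))) ∂κ (t + k) ζ' ∂M.condLaw κ ζ k
  | 0, _ => by
    have : M.totalUtility u π t 0 = fun _ => 0 := rfl
    rw [this]
    exact ⟨measurable_const, integrable_const _, by simp⟩
  | K + 1, hK => by
    obtain ⟨hm, hi, he⟩ := integral_totalUtility H hπ hu ζ K (by omega)
    have hs : t + K < M.T := by omega
    let g : M.ObsHist (t + K + 1) → ℝ := fun ζ' => u (t + K) (Hist.init ζ')
      (M.h (t + K) (π (t + K) (Hist.init ζ'),
        ((Hist.last ζ' : M.Ξ (t + K)) : EuclideanSpace ℝ (Fin (M.d (t + K))))))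
    have hg : Measurable g := (hu _ hs).1.comp (Hist.measurable_init.prodMk
      ((H.measurable_h hs).comp (((hπ _ hs).comp Hist.measurable_init).prodMk
        Hist.measurable_last)))
    have hmi : Measurable (fun ζ' : M.ObsHist (t + K + 1) =>
        M.totalUtility u π t K (Hist.init ζ')) := hm.comp Hist.measurable_init
    have hbi : Integrable (fun ζ' : M.ObsHist (t + K + 1) => b (t + K) (Hist.init ζ'))
        (M.condLaw κ ζ (K + 1)) := by
      have := H.integrable_b t K hs ζ
      rw [← M.map_init_condLaw_succ ζ K] at this
      exact (integrable_map_measure (H.measurable_b _ hs).aestronglyMeasurable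
        Hist.measurable_init.aemeasurable).1 this
    have hgi : Integrable g (M.condLaw κ ζ (K + 1)) :=
      hbi.mono' hg.aestronglyMeasurable
        (Eventually.of_forall fun ζ' => H.bound_U _ hs _ _ ((hu _ hs).2 _) _)
    have hti : Integrable (fun ζ' : M.ObsHist (t + K + 1) =>
        M.totalUtility u π t K (Hist.init ζ')) (M.condLaw κ ζ (K + 1)) := by
      rw [← M.map_init_condLaw_succ ζ K] at hi
      exact (integrable_map_measure hm.aestronglyMeasurable
        Hist.measurable_init.aemeasurable).1 hi
    refine ⟨hmi.add hg, hti.add hgi, ?_⟩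
    rw [Finset.sum_range_succ, ← he]
    refine (integral_add hti hgi).trans ?_
    congr 1
    · conv_rhs => rw [← M.map_init_condLaw_succ ζ K]
      exact (integral_map Hist.measurable_init.aemeasurable hm.aestronglyMeasurable).symm
    · exact M.integral_condLaw_succ ζ K hg hgi

/-- A utility sequence that is almost the worst one for a policy, at every stage and history. -/
theorem exists_almost_worst (H : M.Regular κ p b) {π : M.Policy} (hπ : M.Implementable π)
    {ε : ℝ} (hε : 0 < ε) : ∃ u ∈ M.ambiguitySet, ∀ s < M.T, ∀ ζ,
      ∫ z, u s ζ (M.h s (π s ζ, (z : EuclideanSpace ℝ (Fin (M.d s))))) ∂κ s ζ ≤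
        M.reward κ s (π s ζ) ζ + ε := by
  classical
  have hstage : ∀ s, ∃ w : M.ObsHist s → ℝ → ℝ, s < M.T →
      (Measurable (fun q : M.ObsHist s × ℝ => w q.1 q.2) ∧ ∀ ζ, w ζ ∈ M.U s ζ) ∧ ∀ ζ,
        ∫ z, w ζ (M.h s (π s ζ, (z : EuclideanSpace ℝ (Fin (M.d s))))) ∂κ s ζ ≤
          M.reward κ s (π s ζ) ζ + ε := by
    intro s
    by_cases hs : s < M.T
    swap
    · exact ⟨fun _ _ => 0, fun h => absurd h hs⟩
    obtain ⟨v, hvm, hvU, hv⟩ := H.exists_dense hs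
    have hex : ∀ ζ, ∃ k, ∫ z, v k ζ (M.h s (π s ζ, (z : EuclideanSpace ℝ (Fin (M.d s))))) ∂κ s ζ ≤
        M.reward κ s (π s ζ) ζ + ε := by
      intro ζ
      have : ⨅ k, ∫ z, v k ζ (M.h s (π s ζ, (z : EuclideanSpace ℝ (Fin (M.d s))))) ∂κ s ζ <
          M.reward κ s (π s ζ) ζ + ε := by
        rw [← hv]
        linarith
      obtain ⟨k, hk⟩ := exists_lt_of_ciInf_lt this
      exact ⟨k, hk.le⟩
    -- The least index of a dense selection that is within `ε` of the infimum depends measurably on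
    -- the history.
    have hfind : Measurable (fun ζ => Nat.find (hex ζ)) := measurable_find _ fun k =>
      measurableSet_le ((H.measurable_integral_utility hs (hvm k)).comp
        ((hπ s hs).prodMk measurable_id)) ((H.measurable_reward_policy hπ hs).add_const ε)
    refine ⟨fun ζ => v (Nat.find (hex ζ)) ζ, fun _ => ⟨⟨?_, fun ζ => hvU _ ζ⟩,
      fun ζ => Nat.find_spec (hex ζ)⟩⟩
    have h1 : Measurable (fun a : ℕ × (M.ObsHist s × ℝ) => v a.1 a.2.1 a.2.2) :=
      measurable_from_prod_countable_right hvm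
    exact h1.comp ((hfind.comp measurable_fst).prodMk measurable_id)
  choose w hw using hstage
  exact ⟨w, fun s hs => (hw s hs).1, fun s hs => (hw s hs).2⟩

/-- Interchange of infimum and expectation. Each utility sequence gives at least the sum of the
rewards, stage by stage, and the almost worst sequence comes arbitrarily close to it. -/
theorem subRobustValue_eq (H : M.Regular κ p b) {π : M.Policy} (hπ : M.Implementable π)
    {t : ℕ} (ht : t ≤ M.T) (ζ : M.ObsHist t) :
    M.subRobustValue κ ζ π = ∑ k ∈ Finset.range (M.T - t),
      ∫ ζ', M.reward κ (t + k) (π (t + k) ζ') ζ' ∂M.condLaw κ ζ k := by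
  have hu0 := H.exists_almost_worst hπ one_pos
  have : Nonempty M.ambiguitySet := ⟨⟨hu0.choose, hu0.choose_spec.1⟩⟩
  have hlow : ∀ u : M.ambiguitySet, ∑ k ∈ Finset.range (M.T - t),
      ∫ ζ', M.reward κ (t + k) (π (t + k) ζ') ζ' ∂M.condLaw κ ζ k ≤
        ∫ ζ', M.totalUtility u.1 π t (M.T - t) ζ' ∂(M.condLaw κ ζ (M.T - t)) := by
    intro u
    rw [(H.integral_totalUtility hπ u.2 ζ (M.T - t) (by omega)).2.2]
    refine Finset.sum_le_sum fun k hk => ?_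
    have hk' : t + k < M.T := by have := Finset.mem_range.1 hk; omega
    exact integral_mono (H.integrable_reward_policy hπ hk' ζ)
      (H.integrable_integral_policy hπ u.2 hk' ζ)
      fun ζ' => H.reward_le hk' ζ' _ ((u.2 _ hk').2 ζ')
  refine le_antisymm (le_of_forall_pos_le_add fun ε hε => ?_) (le_ciInf hlow)
  -- The error is shared among `M.T - t` stages; the added `1` keeps the divisor positive when no
  -- stage remains.
  set N : ℝ := (M.T - t : ℕ) + 1 with hN
  have hNpos : 0 < N := by positivity
  obtain ⟨u, hu, hle⟩ := H.exists_almost_worst hπ (div_pos hε hNpos)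
  refine (ciInf_le ⟨_, by rintro _ ⟨u, rfl⟩; exact hlow u⟩ (⟨u, hu⟩ : M.ambiguitySet)).trans ?_
  rw [(H.integral_totalUtility hπ hu ζ (M.T - t) (by omega)).2.2]
  have hsum : ∑ k ∈ Finset.range (M.T - t), ∫ ζ', ∫ z, u (t + k) ζ' (M.h (t + k) (π (t + k) ζ',
      (z : EuclideanSpace ℝ (Fin (M.d (t + k)))))) ∂κ (t + k) ζ' ∂M.condLaw κ ζ k ≤
      ∑ k ∈ Finset.range (M.T - t),
        (∫ ζ', M.reward κ (t + k) (π (t + k) ζ') ζ' ∂M.condLaw κ ζ k + ε / N) := by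
    refine Finset.sum_le_sum fun k hk => ?_
    have hk' : t + k < M.T := by have := Finset.mem_range.1 hk; omega
    have hi := H.integrable_reward_policy hπ hk' ζ
    have h1 := integral_mono (H.integrable_integral_policy hπ hu hk' ζ)
      (hi.add (integrable_const (ε / N))) fun ζ' => hle _ hk' ζ'
    refine h1.trans (le_of_eq ?_)
    refine (integral_add hi (integrable_const _)).trans ?_
    simp
  refine hsum.trans ?_
  rw [Finset.sum_add_distrib, Finset.sum_const, Finset.card_range, nsmul_eq_mul]
  refine add_le_add le_rfl ?_
  rw [mul_div_assoc', div_le_iff₀ hNpos, mul_comm]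
  exact mul_le_mul_of_nonneg_left (by linarith) hε.le

end Regular

/-! ### The loss of a policy at a stage -/

variable (κ) in
/-- The loss incurred at stage `t` by the decision `y` compared with an optimal one. -/
def loss (t : ℕ) (x : M.DecHist t) (y : M.Dec t) (ζ : M.ObsHist t) : ℝ :=
  M.value κ t x ζ - M.reward κ t y ζ -
    ∫ z, M.value κ (t + 1) (Hist.snoc x y) (Hist.snoc ζ z) ∂κ t ζ

theorem measurable_decisionsFrom {π : M.Policy} (hπ : M.Implementable π) {t : ℕ}
    (x : M.DecHist t) : ∀ k, t + k ≤ M.T → Measurable (M.decisionsFrom π x k)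
  | 0, _ => measurable_const
  | k + 1, hk => Hist.measurable_snoc.comp
      (((measurable_decisionsFrom hπ x k (by omega)).comp Hist.measurable_init).prodMk
        ((hπ (t + k) (by omega)).comp Hist.measurable_init))

namespace Regular

theorem loss_eq (H : M.Regular κ p b) {t : ℕ} (ht : t < M.T) (x : M.DecHist t) (y : M.Dec t)
    (ζ : M.ObsHist t) : M.loss κ t x y ζ =
      M.value κ t x ζ - M.stageObjective κ t (M.value κ (t + 1)) x ζ y := by
  rw [H.stageObjective_eq ht _ x ζ y (H.integrable_value_snoc ht ζ _), loss]
  ring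

theorem loss_nonneg (H : M.Regular κ p b) {t : ℕ} (ht : t < M.T) {x : M.DecHist t} {y : M.Dec t}
    {ζ : M.ObsHist t} (hx : M.FeasHist t x ζ) (hy : y ∈ M.X t x ζ) : 0 ≤ M.loss κ t x y ζ := by
  rw [H.loss_eq ht, sub_nonneg]
  exact (H.isGreatest_value ht hx).2 ⟨y, hy, rfl⟩

section

variable {π : M.Policy} {t : ℕ}

theorem measurable_value_decisionsFrom (H : M.Regular κ p b) (hπ : M.Implementable π)
    (x : M.DecHist t) {k : ℕ} (hk : t + k ≤ M.T) :
    Measurable (fun ζ' => M.value κ (t + k) (M.decisionsFrom π x k ζ') ζ') :=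
  (H.regularAt hk).measurable.comp ((measurable_decisionsFrom hπ x k hk).prodMk measurable_id)

theorem integrable_value_decisionsFrom (H : M.Regular κ p b) (hπ : M.Implementable π)
    (x : M.DecHist t) (ζ : M.ObsHist t) {k : ℕ} (hk : t + k ≤ M.T) :
    Integrable (fun ζ' => M.value κ (t + k) (M.decisionsFrom π x k ζ') ζ') (M.condLaw κ ζ k) :=
  (H.integrable_tailBound ζ hk).mono'
    (H.measurable_value_decisionsFrom hπ x hk).aestronglyMeasurable
    (Eventually.of_forall fun _ => (H.regularAt hk).abs_le _ _)

/-- Fubini: the value of the next stage is integrable under the next conditional law, which is the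
image of a composition-product. -/
theorem integrable_next_value (H : M.Regular κ p b) (hπ : M.Implementable π)
    (x : M.DecHist t) (ζ : M.ObsHist t) {k : ℕ} (hk : t + k < M.T) :
    Integrable (fun ζ' => ∫ z, M.value κ (t + k + 1)
      (Hist.snoc (M.decisionsFrom π x k ζ') (π (t + k) ζ')) (Hist.snoc ζ' z) ∂κ (t + k) ζ')
      (M.condLaw κ ζ k) := by
  have h1 := H.integrable_value_decisionsFrom hπ x ζ (k := k + 1) hk
  have h2 := H.measurable_value_decisionsFrom hπ x (k := k + 1) hk
  rw [condLaw] at h1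
  have h3 := (integrable_map_measure h2.aestronglyMeasurable
    Hist.measurable_snoc.aemeasurable).1 h1
  have h4 := (Measure.integrable_compProd_iff (μ := M.condLaw κ ζ k) (κ := κ (t + k))
    h3.aestronglyMeasurable).1 h3
  have h5 : Measurable (fun ζ' => ∫ z, M.value κ (t + k + 1)
      (Hist.snoc (M.decisionsFrom π x k ζ') (π (t + k) ζ')) (Hist.snoc ζ' z) ∂κ (t + k) ζ') :=
    (StronglyMeasurable.integral_kernel_prod_right'
      (h2.comp Hist.measurable_snoc).stronglyMeasurable).measurable
  exact h4.2.mono' h5.aestronglyMeasurable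
    (Eventually.of_forall fun ζ' => norm_integral_le_integral_norm _)

theorem integrable_loss (H : M.Regular κ p b) (hπ : M.Implementable π)
    (x : M.DecHist t) (ζ : M.ObsHist t) {k : ℕ} (hk : t + k < M.T) :
    Integrable (fun ζ' => M.loss κ (t + k) (M.decisionsFrom π x k ζ') (π (t + k) ζ') ζ')
      (M.condLaw κ ζ k) :=
  ((H.integrable_value_decisionsFrom hπ x ζ hk.le).sub
    (H.integrable_reward_policy hπ hk ζ)).sub (H.integrable_next_value hπ x ζ hk)

theorem integral_loss (H : M.Regular κ p b) (hπ : M.Implementable π)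
    (x : M.DecHist t) (ζ : M.ObsHist t) {k : ℕ} (hk : t + k < M.T) :
    ∫ ζ', M.loss κ (t + k) (M.decisionsFrom π x k ζ') (π (t + k) ζ') ζ' ∂M.condLaw κ ζ k =
      ∫ ζ', M.value κ (t + k) (M.decisionsFrom π x k ζ') ζ' ∂M.condLaw κ ζ k -
      ∫ ζ', M.reward κ (t + k) (π (t + k) ζ') ζ' ∂M.condLaw κ ζ k -
      ∫ ζ', M.value κ (t + (k + 1)) (M.decisionsFrom π x (k + 1) ζ') ζ'
        ∂M.condLaw κ ζ (k + 1) := by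
  have h1 := H.integrable_value_decisionsFrom hπ x ζ hk.le
  have h2 := H.integrable_reward_policy hπ hk ζ
  have h3 := H.integrable_next_value hπ x ζ hk
  refine (integral_sub (h1.sub h2) h3).trans ?_
  refine congr_arg₂ _ (integral_sub h1 h2) ?_
  exact (M.integral_condLaw_succ ζ k (H.measurable_value_decisionsFrom hπ x (k := k + 1) hk)
    (H.integrable_value_decisionsFrom hπ x ζ (k := k + 1) hk)).symm

/-- The difference between the value function and the worst-case value of a policy is the sum of
the expected losses. -/
theorem value_sub_subRobustValue (H : M.Regular κ p b) (hπ : M.Implementable π) (ht : t ≤ M.T)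
    (x : M.DecHist t) (ζ : M.ObsHist t) :
    M.value κ t x ζ - M.subRobustValue κ ζ π = ∑ k ∈ Finset.range (M.T - t),
      ∫ ζ', M.loss κ (t + k) (M.decisionsFrom π x k ζ') (π (t + k) ζ') ζ' ∂M.condLaw κ ζ k := by
  -- The summands are rearranged so that the two value terms telescope, from the value at the given
  -- history down to the terminal value `0`.
  have hsum : ∑ k ∈ Finset.range (M.T - t),
      ∫ ζ', M.loss κ (t + k) (M.decisionsFrom π x k ζ') (π (t + k) ζ') ζ' ∂M.condLaw κ ζ k =
      ∑ k ∈ Finset.range (M.T - t),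
        ((∫ ζ', M.value κ (t + k) (M.decisionsFrom π x k ζ') ζ' ∂M.condLaw κ ζ k -
          ∫ ζ', M.value κ (t + (k + 1)) (M.decisionsFrom π x (k + 1) ζ') ζ'
            ∂M.condLaw κ ζ (k + 1)) -
        ∫ ζ', M.reward κ (t + k) (π (t + k) ζ') ζ' ∂M.condLaw κ ζ k) := by
    refine Finset.sum_congr rfl fun k hk => ?_
    rw [H.integral_loss hπ x ζ (by have := Finset.mem_range.1 hk; omega)]
    ring
  have h0 : ∫ ζ', M.value κ (t + 0) (M.decisionsFrom π x 0 ζ') ζ' ∂M.condLaw κ ζ 0 =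
      M.value κ t x ζ :=
    integral_dirac (fun ζ' => M.value κ t x ζ') ζ
  have hT : ∫ ζ', M.value κ (t + (M.T - t)) (M.decisionsFrom π x (M.T - t) ζ') ζ'
      ∂M.condLaw κ ζ (M.T - t) = 0 := by
    simp_rw [M.value_eq_zero κ (t := t + (M.T - t)) (by omega)]
    simp
  rw [hsum, Finset.sum_sub_distrib, ← H.subRobustValue_eq hπ ht ζ, Finset.sum_range_sub'
    (fun k => ∫ ζ', M.value κ (t + k) (M.decisionsFrom π x k ζ') ζ' ∂M.condLaw κ ζ k), h0, hT,
    sub_zero]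

end

end Regular

/-! ### Optimality in the sub-problems -/

theorem ae_condLaw_zero {t : ℕ} {ζ : M.ObsHist t} {q : M.ObsHist t → Prop} (h : q ζ) :
    ∀ᵐ ζ' ∂M.condLaw κ ζ 0, q ζ' := by
  have : ∀ᵐ ζ' ∂(Measure.dirac ζ : Measure (M.ObsHist t)), q ζ' := by
    rw [ae_dirac_eq]
    exact h
  exact this

/-- The decision histories generated by decision rules `σ` that depend on both histories. -/
def decisionsOfRule (σ : ∀ s, M.DecHist s × M.ObsHist s → M.Dec s) {t : ℕ} (x : M.DecHist t) :
    ∀ k, M.ObsHist (t + k) → M.DecHist (t + k)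
  | 0, _ => x
  | k + 1, ζ => Hist.snoc (decisionsOfRule σ x k (Hist.init ζ))
      (σ (t + k) (decisionsOfRule σ x k (Hist.init ζ), Hist.init ζ))

theorem measurable_decisionsOfRule {σ : ∀ s, M.DecHist s × M.ObsHist s → M.Dec s}
    (hσ : ∀ s, Measurable (σ s)) {t : ℕ} (x : M.DecHist t) :
    ∀ k, Measurable (M.decisionsOfRule σ x k)
  | 0 => measurable_const
  | k + 1 => by
    have h := (measurable_decisionsOfRule hσ x k).comp Hist.measurable_init
    exact Hist.measurable_snoc.comp
      (h.prodMk ((hσ (t + k)).comp (h.prodMk Hist.measurable_init)))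

/-- Heterogeneous equality handles the dependence of the decision space on `s = t + k`. Decisions
before stage `t` are irrelevant and set to `0`. -/
theorem exists_policy_extending {t : ℕ} (f : ∀ k, M.ObsHist (t + k) → M.Dec (t + k))
    (hf : ∀ k, Measurable (f k)) :
    ∃ π : M.Policy, (∀ s, Measurable (π s)) ∧ ∀ k, π (t + k) = f k := by
  have h : ∀ s, ∃ g : M.ObsHist s → M.Dec s, Measurable g ∧ ∀ k, s = t + k → HEq g (f k) := by
    intro s
    by_cases hs : ∃ k, s = t + k
    · obtain ⟨k, rfl⟩ := hs
      refine ⟨f k, hf k, fun k' hk' => ?_⟩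
      obtain rfl : k = k' := by omega
      exact HEq.rfl
    · exact ⟨fun _ => 0, measurable_const, fun k hk => absurd ⟨k, hk⟩ hs⟩
  choose π hπ hπf using h
  exact ⟨π, hπ, fun k => eq_of_heq (hπf (t + k) k rfl)⟩

theorem SubFeasible.ae_feasHist {π : M.Policy} {t : ℕ} {x : M.DecHist t} {ζ : M.ObsHist t}
    (hπ : M.SubFeasible κ x ζ π) (hx : M.FeasHist t x ζ) :
    ∀ k, t + k ≤ M.T →
      ∀ᵐ ζ' ∂M.condLaw κ ζ k, M.FeasHist (t + k) (M.decisionsFrom π x k ζ') ζ'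
  | 0, _ => ae_condLaw_zero hx
  | k + 1, hk => M.ae_condLaw_succ_of_init ζ k
      ((SubFeasible.ae_feasHist hπ hx k (by omega)).and (hπ.2 k (by omega)))

namespace Regular

variable {π : M.Policy} {t : ℕ} {x : M.DecHist t} {ζ : M.ObsHist t}

theorem ae_loss_nonneg (H : M.Regular κ p b) (hπ : M.SubFeasible κ x ζ π)
    (hx : M.FeasHist t x ζ) {k : ℕ} (hk : t + k < M.T) : ∀ᵐ ζ' ∂M.condLaw κ ζ k,
      0 ≤ M.loss κ (t + k) (M.decisionsFrom π x k ζ') (π (t + k) ζ') ζ' := by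
  filter_upwards [hπ.ae_feasHist hx k hk.le, hπ.2 k hk] with ζ' h1 h2
  exact H.loss_nonneg hk h1 h2

theorem subRobustValue_le_value (H : M.Regular κ p b) (ht : t ≤ M.T)
    (hπ : M.SubFeasible κ x ζ π) (hx : M.FeasHist t x ζ) :
    M.subRobustValue κ ζ π ≤ M.value κ t x ζ := by
  rw [← sub_nonneg, H.value_sub_subRobustValue hπ.1 ht]
  refine Finset.sum_nonneg fun k hk => integral_nonneg_of_ae ?_
  exact H.ae_loss_nonneg hπ hx (by have := Finset.mem_range.1 hk; omega)

theorem subRobustValue_eq_value (H : M.Regular κ p b) (ht : t ≤ M.T) (hπ : M.Implementable π)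
    (h : ∀ k, t + k < M.T → ∀ᵐ ζ' ∂M.condLaw κ ζ k,
      M.loss κ (t + k) (M.decisionsFrom π x k ζ') (π (t + k) ζ') ζ' = 0) :
    M.subRobustValue κ ζ π = M.value κ t x ζ := by
  symm
  rw [← sub_eq_zero, H.value_sub_subRobustValue hπ ht]
  exact Finset.sum_eq_zero fun k hk => integral_eq_zero_of_ae
    (h k (by have := Finset.mem_range.1 hk; omega))

/-- The expected losses are nonnegative and sum to zero, so each is zero, and a nonnegative function
with zero integral vanishes almost everywhere. -/
theorem ae_loss_eq_zero (H : M.Regular κ p b) (ht : t ≤ M.T) (hπ : M.SubFeasible κ x ζ π)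
    (hx : M.FeasHist t x ζ) (h : M.subRobustValue κ ζ π = M.value κ t x ζ) {k : ℕ}
    (hk : t + k < M.T) : ∀ᵐ ζ' ∂M.condLaw κ ζ k,
      M.loss κ (t + k) (M.decisionsFrom π x k ζ') (π (t + k) ζ') ζ' = 0 := by
  have hsum := H.value_sub_subRobustValue hπ.1 ht x ζ
  rw [h, sub_self, eq_comm, Finset.sum_eq_zero_iff_of_nonneg fun j hj => integral_nonneg_of_ae
    (H.ae_loss_nonneg hπ hx (by have := Finset.mem_range.1 hj; omega))] at hsum
  exact (integral_eq_zero_iff_of_nonneg_ae (H.ae_loss_nonneg hπ hx hk)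
    (H.integrable_loss hπ.1 x ζ hk)).1 (hsum k (Finset.mem_range.2 (by omega)))

theorem exists_subFeasible_eq_value (H : M.Regular κ p b) (ht : t ≤ M.T)
    (hx : M.FeasHist t x ζ) :
    ∃ π, M.SubFeasible κ x ζ π ∧ M.subRobustValue κ ζ π = M.value κ t x ζ := by
  have hσ : ∀ s, ∃ σ : M.DecHist s × M.ObsHist s → M.Dec s, Measurable σ ∧
      (s < M.T → ∀ x ζ, M.FeasHist s x ζ → σ (x, ζ) ∈ M.X s x ζ ∧
        M.stageObjective κ s (M.value κ (s + 1)) x ζ (σ (x, ζ)) = M.value κ s x ζ) := by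
    intro s
    by_cases hs : s < M.T
    · obtain ⟨σ, h1, h2⟩ := H.exists_optimal_decision hs
      exact ⟨σ, h1, fun _ => h2⟩
    · exact ⟨fun _ => 0, measurable_const, fun h => absurd h hs⟩
  choose σ hσm hσ using hσ
  -- The optimal rule uses past decisions as well. Feeding it the decisions that it has itself
  -- generated from `x` leaves a function of the observations alone.
  obtain ⟨π, hπm, hπ⟩ := exists_policy_extending
    (fun k ζ' => σ (t + k) (M.decisionsOfRule σ x k ζ', ζ'))
    fun k => (hσm _).comp ((measurable_decisionsOfRule hσm x k).prodMk measurable_id)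
  have hdec : ∀ k ζ', M.decisionsFrom π x k ζ' = M.decisionsOfRule σ x k ζ' := by
    intro k
    induction k with
    | zero => exact fun _ => rfl
    | succ k ih =>
      intro ζ'
      rw [decisionsFrom, decisionsOfRule, ih, hπ]
  have hπ' : ∀ k ζ', π (t + k) ζ' = σ (t + k) (M.decisionsFrom π x k ζ', ζ') := fun k ζ' => by
    rw [hdec, hπ]
  have himpl : M.Implementable π := fun s _ => hπm s
  have hfeas : ∀ k, t + k ≤ M.T →
      ∀ᵐ ζ' ∂M.condLaw κ ζ k, M.FeasHist (t + k) (M.decisionsFrom π x k ζ') ζ' := by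
    intro k
    induction k with
    | zero =>
      intro _
      exact ae_condLaw_zero hx
    | succ k ih =>
      intro hk
      refine M.ae_condLaw_succ_of_init ζ k (q := fun ζ' =>
        M.FeasHist (t + k) (M.decisionsFrom π x k ζ') ζ' ∧
          π (t + k) ζ' ∈ M.X (t + k) (M.decisionsFrom π x k ζ') ζ') ?_
      filter_upwards [ih (by omega)] with ζ' h
      exact ⟨h, hπ' k ζ' ▸ (hσ _ (by omega) _ _ h).1⟩
  refine ⟨π, ⟨himpl, fun k hk => ?_⟩, H.subRobustValue_eq_value ht himpl fun k hk => ?_⟩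
  · filter_upwards [hfeas k hk.le] with ζ' h
    exact hπ' k ζ' ▸ (hσ _ hk _ _ h).1
  · filter_upwards [hfeas k hk.le] with ζ' h
    rw [H.loss_eq hk, hπ', (hσ _ hk _ _ h).2, sub_self]

theorem isGreatest_subRobustValue (H : M.Regular κ p b) (ht : t ≤ M.T) (hx : M.FeasHist t x ζ) :
    IsGreatest (M.subRobustValue κ ζ '' {π | M.SubFeasible κ x ζ π}) (M.value κ t x ζ) := by
  refine ⟨H.exists_subFeasible_eq_value ht hx, ?_⟩
  rintro _ ⟨π, hπ, rfl⟩
  exact H.subRobustValue_le_value ht hπ hx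

end Regular

/-! ### The problem (MS-PRO-SD) as the sub-problem of the first stage -/

section Global

variable {Ω : Type*} [MeasurableSpace Ω] {P : Measure Ω} [IsProbabilityMeasure P]
  {ξ : ∀ t, Ω → M.Ξ t}

theorem measurable_histOf (hξ : ∀ t, Measurable (ξ t)) : ∀ t, Measurable (histOf ξ t)
  | 0 => measurable_const
  | t + 1 => Hist.measurable_snoc.comp ((measurable_histOf hξ t).prodMk (hξ t))

theorem map_histOf_succ (hξ : ∀ t, Measurable (ξ t)) {t : ℕ}
    (hκ : HasCondDistrib (ξ t) (histOf ξ t) (κ t) P) :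
    P.map (histOf ξ (t + 1)) =
      (P.map (histOf ξ t) ⊗ₘ κ t).map (fun q => Hist.snoc q.1 q.2) := by
  rw [← HasLaw.map_eq hκ, Measure.map_map Hist.measurable_snoc
    ((measurable_histOf hξ t).prodMk (hξ t))]
  rfl

theorem map_histOf_eq_condLaw (hξ : ∀ t, Measurable (ξ t))
    (hκ : ∀ t < M.T, HasCondDistrib (ξ t) (histOf ξ t) (κ t) P) :
    ∀ k, 0 + k ≤ M.T → P.map (histOf ξ (0 + k)) = M.condLaw κ (t := 0) () k
  | 0, _ => by
    have : histOf ξ (0 + 0) = fun _ => (() : Unit) := rfl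
    rw [this]
    refine (Measure.map_const P _).trans ?_
    rw [measure_univ, one_smul]
    rfl
  | k + 1, hk => by
    refine (map_histOf_succ hξ (hκ (0 + k) (by omega))).trans ?_
    rw [map_histOf_eq_condLaw hξ hκ k (by omega)]
    rfl

/-- A property that holds almost surely for the history of stage `t + k` holds almost surely under
the conditional laws given the history of stage `t`. -/
theorem ae_condLaw_of_ae_map_histOf (hξ : ∀ t, Measurable (ξ t))
    (hκ : ∀ t < M.T, HasCondDistrib (ξ t) (histOf ξ t) (κ t) P) {t : ℕ} :
    ∀ k, t + k ≤ M.T → ∀ q : M.ObsHist (t + k) → Prop,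
      (∀ᵐ ζ' ∂P.map (histOf ξ (t + k)), q ζ') →
      ∀ᵐ ζ ∂P.map (histOf ξ t), ∀ᵐ ζ' ∂M.condLaw κ ζ k, q ζ'
  | 0, _, q, h => by
    filter_upwards [h] with ζ hζ
    exact ae_condLaw_zero hζ
  | k + 1, hk, q, h => by
    -- The property need not be measurable, so its exceptional set is enlarged to a measurable null
    -- set before the law is disintegrated.
    obtain ⟨s, hsub, hs, hs0⟩ := exists_measurable_superset_of_null (ae_iff.1 h)
    have h1 : ∀ᵐ ζ' ∂P.map (histOf ξ (t + k + 1)), ζ' ∈ sᶜ :=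
      measure_eq_zero_iff_ae_notMem.1 hs0
    rw [map_histOf_succ hξ (hκ (t + k) (by omega))] at h1
    have h2 := ae_of_ae_map Hist.measurable_snoc.aemeasurable h1
    have : IsProbabilityMeasure (P.map (histOf ξ (t + k))) :=
      Measure.isProbabilityMeasure_map (measurable_histOf hξ _).aemeasurable
    have h3 := Measure.ae_ae_of_ae_compProd (μ := P.map (histOf ξ (t + k))) (κ := κ (t + k)) h2
    filter_upwards [ae_condLaw_of_ae_map_histOf hξ hκ k (by omega) _ h3] with ζ hζ
    have h4 : ∀ᵐ a ∂(M.condLaw κ ζ k ⊗ₘ κ (t + k)), Hist.snoc a.1 a.2 ∈ sᶜ :=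
      Measure.ae_compProd_of_ae_ae (Hist.measurable_snoc hs.compl) hζ
    have h5 : ∀ᵐ ζ' ∂M.condLaw κ ζ (k + 1), ζ' ∈ sᶜ := by
      rw [condLaw]
      exact (ae_map_iff Hist.measurable_snoc.aemeasurable hs.compl).2 h4
    filter_upwards [h5] with ζ' h6
    by_contra h7
    exact h6 (hsub h7)

theorem decisions_zero_add (π : M.Policy) : ∀ k (ζ : M.ObsHist (0 + k)),
    M.decisions π (0 + k) ζ = M.decisionsFrom (t := 0) π () k ζ
  | 0, _ => rfl
  | k + 1, ζ => congrArg (fun x => Hist.snoc x (π (0 + k) (Hist.init ζ)))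
      (decisions_zero_add π k (Hist.init ζ))

/-- The conditional law is concentrated on histories that extend `ζ`, so applying the policy from
the outset or from stage `t` on gives the same decisions. -/
theorem ae_decisions_eq (π : M.Policy) {t : ℕ} (ζ : M.ObsHist t) : ∀ k,
    ∀ᵐ ζ' ∂M.condLaw κ ζ k,
      M.decisions π (t + k) ζ' = M.decisionsFrom π (M.decisions π t ζ) k ζ'
  | 0 => ae_condLaw_zero rfl
  | k + 1 => by
    refine (M.ae_condLaw_succ_of_init ζ k (ae_decisions_eq π ζ k)).mono fun ζ' h => ?_
    rw [decisionsFrom, ← h]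
    rfl

theorem measurable_decisions {π : M.Policy} (hπ : M.Implementable π) :
    ∀ t, t ≤ M.T → Measurable (M.decisions π t)
  | 0, _ => measurable_const
  | t + 1, ht => Hist.measurable_snoc.comp
      (((measurable_decisions hπ t (by omega)).comp Hist.measurable_init).prodMk
        ((hπ t (by omega)).comp Hist.measurable_init))

theorem Feasible.ae_feasHist {π : M.Policy} (hπ : M.Feasible P ξ π) : ∀ t, t ≤ M.T →
    ∀ᵐ ω ∂P, M.FeasHist t (M.decisions π t (histOf ξ t ω)) (histOf ξ t ω)
  | 0, _ => Eventually.of_forall fun _ => trivial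
  | t + 1, ht => (Feasible.ae_feasHist hπ t (by omega)).and (hπ.2 t (by omega))

namespace Regular

/-- Transfer from `P` to the law of the history requires a measurable event; it is the preimage of
the measurable graph of `feasNext`. -/
theorem ae_map_feasNext (H : M.Regular κ p b) (hξ : ∀ t, Measurable (ξ t)) {π : M.Policy}
    (hπ : M.Feasible P ξ π) {t : ℕ} (ht : t < M.T) : ∀ᵐ ζ ∂P.map (histOf ξ t),
      M.FeasHist t (M.decisions π t ζ) ζ ∧ π t ζ ∈ M.X t (M.decisions π t ζ) ζ := by
  have hm : MeasurableSet {ζ : M.ObsHist t |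
      M.FeasHist t (M.decisions π t ζ) ζ ∧ π t ζ ∈ M.X t (M.decisions π t ζ) ζ} := by
    have h1 : Measurable (fun ζ : M.ObsHist t => (Hist.snoc (M.decisions π t ζ) (π t ζ), ζ)) :=
      (Hist.measurable_snoc.comp ((measurable_decisions hπ.1 t ht.le).prodMk
        (hπ.1 t ht))).prodMk measurable_id
    exact h1 (H.measCompact_feasNext ht).measurableSet_graph
  refine (ae_map_iff (measurable_histOf hξ t).aemeasurable hm).2 ?_
  exact (hπ.ae_feasHist t ht.le).and (hπ.2 t ht)

theorem feasible_iff_subFeasible (H : M.Regular κ p b) (hξ : ∀ t, Measurable (ξ t))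
    (hκ : ∀ t < M.T, HasCondDistrib (ξ t) (histOf ξ t) (κ t) P) {π : M.Policy} :
    M.Feasible P ξ π ↔ M.SubFeasible κ (t := 0) () () π := by
  constructor
  · refine fun hπ => ⟨hπ.1, fun k hk => ?_⟩
    have := H.ae_map_feasNext hξ hπ hk
    rw [map_histOf_eq_condLaw hξ hκ k hk.le] at this
    filter_upwards [this] with ζ hζ
    rw [← decisions_zero_add]
    exact hζ.2
  · refine fun hπ => ⟨hπ.1, fun k hk => ?_⟩
    rw [← Nat.zero_add k] at hk ⊢
    have := hπ.2 k hk
    rw [← map_histOf_eq_condLaw hξ hκ k hk.le] at this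
    filter_upwards [ae_of_ae_map (measurable_histOf hξ _).aemeasurable this] with ω hω
    rw [decisions_zero_add]
    exact hω

/-- The expectations agree for each utility sequence separately, by change of variables along the
history map. -/
theorem robustValue_eq_subRobustValue (H : M.Regular κ p b) (hξ : ∀ t, Measurable (ξ t))
    (hκ : ∀ t < M.T, HasCondDistrib (ξ t) (histOf ξ t) (κ t) P) {π : M.Policy}
    (hπ : M.Implementable π) :
    M.robustValue P ξ π = M.subRobustValue κ (t := 0) () π := by
  refine iInf_congr fun u => ?_
  have hsum : ∀ K ω, M.totalUtility u.1 π 0 K (histOf ξ (0 + K) ω) =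
      ∑ t ∈ Finset.range K, u.1 t (histOf ξ t ω)
        (M.h t (π t (histOf ξ t ω), (ξ t ω : EuclideanSpace ℝ (Fin (M.d t))))) := by
    intro K ω
    induction K with
    | zero => rfl
    | succ K ih =>
      rw [Finset.sum_range_succ, ← ih]
      exact congrArg (M.totalUtility u.1 π 0 K (histOf ξ (0 + K) ω) + ·)
        (congrArg (fun s => u.1 s (histOf ξ s ω) (M.h s (π s (histOf ξ s ω),
          (ξ s ω : EuclideanSpace ℝ (Fin (M.d s)))))) (Nat.zero_add K))
  have hm := (H.integral_totalUtility hπ u.2 (t := 0) () (M.T - 0) (by omega)).1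
  rw [← map_histOf_eq_condLaw hξ hκ (M.T - 0) (by omega), integral_map
    (measurable_histOf hξ _).aemeasurable hm.aestronglyMeasurable]
  exact integral_congr_ae (Eventually.of_forall fun ω => (hsum M.T ω).symm)

theorem isGreatest_robustValue (H : M.Regular κ p b) (hξ : ∀ t, Measurable (ξ t))
    (hκ : ∀ t < M.T, HasCondDistrib (ξ t) (histOf ξ t) (κ t) P) :
    IsGreatest (M.robustValue P ξ '' {π | M.Feasible P ξ π}) (M.value κ 0 () ()) := by
  convert H.isGreatest_subRobustValue (t := 0) (x := ()) (ζ := ()) (Nat.zero_le _) trivial using 1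
  have hset : {π | M.Feasible P ξ π} = {π | M.SubFeasible κ (t := 0) () () π} :=
    Set.ext fun π => H.feasible_iff_subFeasible hξ hκ
  rw [hset]
  exact Set.image_congr fun π hπ => H.robustValue_eq_subRobustValue hξ hκ hπ.1

theorem timeConsistent (H : M.Regular κ p b) (hξ : ∀ t, Measurable (ξ t))
    (hκ : ∀ t < M.T, HasCondDistrib (ξ t) (histOf ξ t) (κ t) P) :
    M.TimeConsistent κ P ξ := by
  intro π hπ t ht
  have himpl := hπ.1.1
  have hopt : M.subRobustValue κ (t := 0) () π = M.value κ 0 () () := by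
    rw [← H.robustValue_eq_subRobustValue hξ hκ himpl]
    have hgr := H.isGreatest_robustValue hξ hκ
    obtain ⟨π', hπ', he⟩ := hgr.1
    exact le_antisymm (hgr.2 ⟨π, hπ.1, rfl⟩) (he ▸ hπ.2 π' hπ')
  -- Optimality at the empty history means that the value is attained, which forces every loss to
  -- vanish almost surely.
  have hloss : ∀ s < M.T, ∀ᵐ ζ ∂P.map (histOf ξ s),
      M.loss κ s (M.decisions π s ζ) (π s ζ) ζ = 0 := by
    intro s hs
    rw [← Nat.zero_add s] at hs ⊢
    rw [map_histOf_eq_condLaw hξ hκ s hs.le]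
    filter_upwards [H.ae_loss_eq_zero (t := 0) (Nat.zero_le _)
      ((H.feasible_iff_subFeasible hξ hκ).1 hπ.1) trivial hopt hs] with ζ hζ
    rw [decisions_zero_add]
    exact hζ
  -- Feasibility and zero loss pass to the conditional laws given almost every history; they are
  -- exactly what attaining the value of the sub-problem requires.
  have hall : ∀ᵐ ζ ∂P.map (histOf ξ t), ∀ k, t + k < M.T → ∀ᵐ ζ' ∂M.condLaw κ ζ k,
      π (t + k) ζ' ∈ M.X (t + k) (M.decisionsFrom π (M.decisions π t ζ) k ζ') ζ' ∧
        M.loss κ (t + k) (M.decisionsFrom π (M.decisions π t ζ) k ζ') (π (t + k) ζ') ζ' = 0 := by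
    refine ae_all_iff.2 fun k => ?_
    by_cases hk : t + k < M.T
    swap
    · exact Eventually.of_forall fun _ h => absurd h hk
    filter_upwards [ae_condLaw_of_ae_map_histOf hξ hκ k hk.le _
      ((H.ae_map_feasNext hξ hπ.1 hk).and (hloss _ hk))] with ζ hζ _
    filter_upwards [hζ, ae_decisions_eq π ζ k] with ζ' h1 h2
    rw [← h2]
    exact ⟨h1.1.2, h1.2⟩
  have hfeas := hπ.1.ae_feasHist t ht.le
  filter_upwards [ae_of_ae_map (measurable_histOf hξ t).aemeasurable hall, hfeas] with ω h1 h2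
  refine ⟨⟨himpl, fun k hk => (h1 k hk).mono fun _ h => h.1⟩, fun π' hπ' => ?_⟩
  rw [H.subRobustValue_eq_value (x := M.decisions π t (histOf ξ t ω)) ht.le himpl
    fun k hk => (h1 k hk).mono fun _ h => h.2]
  exact H.subRobustValue_le_value ht.le hπ' h2

end Regular

end Global

end Model

end PRO

end

/-! ### The main theorem. -/

theorem mainTheorem2
    (M : PRO.Model)
    {Ω : Type*} [MeasurableSpace Ω] (P : Measure Ω) [IsProbabilityMeasure P]
    -- the process and its regular conditional distributions given the past
    (ξ : ∀ t, Ω → M.Ξ t) (hξ : ∀ t, Measurable (ξ t))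
    (κ : ∀ t, Kernel (M.ObsHist t) (M.Ξ t)) [∀ t, IsMarkovKernel (κ t)]
    (hκ : ∀ t < M.T, HasCondDistrib (ξ t) (PRO.histOf ξ t) (κ t) P)
    -- the reward functions are continuous
    (hh : ∀ t < M.T, Continuous (M.h t))
    -- the feasible sets
    (hXcompact : ∀ t < M.T, ∀ x ζ, IsCompact (M.X t x ζ))
    (hXnonempty : ∀ t < M.T, ∀ x ζ, M.FeasHist t x ζ → (M.X t x ζ).Nonempty)
    (hXuhc : ∀ t < M.T, ∀ ζ, UpperHemicontinuous (fun x => M.X t x ζ))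
    (hXmeas : ∀ t < M.T, PRO.GraphMeasurable (M.X t))
    -- the stage ambiguity sets
    (p : ℝ≥0∞) (hp : 0 < p)
    (hUutil : ∀ t < M.T, ∀ ζ, ∀ u ∈ M.U t ζ, PRO.IsUtility u)
    (hUcompact : ∀ t < M.T, ∀ ζ, PRO.UtilCompact p (M.U t ζ))
    (hUmeas : ∀ t < M.T, PRO.UtilMeasurable p (M.U t))
    -- the utilities at stage `t` are bounded by `b t ξ_[t-1]`, which is conditionally integrable
    (b : ∀ t, M.ObsHist t → ℝ) (hbmeas : ∀ t < M.T, Measurable (b t))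
    (hUbound : ∀ t < M.T, ∀ ζ, ∀ u ∈ M.U t ζ, ∀ y, |u y| ≤ b t ζ)
    (hbint : ∀ t k, t + k < M.T → ∀ ζ : M.ObsHist t,
      Integrable (b (t + k)) (M.condLaw κ ζ k))
    -- rectangularity
    (hrect : M.IsRectangular κ P ξ) :
    ∃ V : ∀ t, M.DecHist t → M.ObsHist t → ℝ,
      -- the backward recursion
      M.SatisfiesRecursion κ V ∧
      -- `V` is the (attained) optimal value of the sub-problems
      (∀ t ≤ M.T, ∀ x ζ, M.FeasHist t x ζ →
        IsGreatest (M.subRobustValue κ ζ '' {π | M.SubFeasible κ x ζ π}) (V t x ζ)) ∧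
      -- in particular its first member is the (attained) optimal value of (MS-PRO-SD)
      IsGreatest (M.robustValue P ξ '' {π | M.Feasible P ξ π}) (V 0 () ()) ∧
      -- and (MS-PRO-SD) is time consistent
      M.TimeConsistent κ P ξ := by
  have H : M.Regular κ p b := ⟨hp, hh, hXcompact, hXnonempty, hXuhc, hXmeas, hUutil, hUmeas,
    hbmeas, hUbound, hbint⟩
  exact ⟨M.value κ, H.satisfiesRecursion, fun t ht x ζ hx => H.isGreatest_subRobustValue ht hx,
    H.isGreatest_robustValue hξ hκ, H.timeConsistent hξ hκ⟩
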